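/- Let $k$ be a field of characteristic $0$. All varieties below are varieties over $k$. Let $\mathrm{End}_2\subset\mathbb{P}^5$ be the variety of endomorphisms $[u:v]\mapsto[a_0u^2+a_1uv+a_2v^2:a_3u^2+a_4uv+a_5v^2]$ of degree $2$ of $\mathbb{P}^1$ (the two quadratic forms have no common root), and let $\widetilde{\mathrm M}_2(6)\subset \mathrm{End}_2\times(\mathbb{P}^1)^6$ be the variety of tuples $(f,p_1,\dots,p_6)$ with $p_1,\dots,p_6$ pairwise distinct, $f(p_i)=p_{i+1}$ for $1\le i\le 5$ and $f(p_6)=p_1$. Let $\mathrm M_2(6)=\widetilde{\mathrm M}_2(6)/\mathrm{PGL}_2$ be the geometric quotient for the action $\nu\cdot(f,p_1,\dots,p_6)=(\nu f\nu^{-1},\nu(p_1),\dots,\nu(p_6))$, and let $\sigma_6$ be the automorphism of $\mathrm M_2(6)$ sending the class of $(f,p_1,\dots,p_6)$ to the class of $(f,p_2,\dots,p_6,p_1)$. Every class has a representative with $(p_1,\dots,p_6)=([0:1],[1:0],[1:1],[x:1],[y:1],[z:1])$ for a unique $(x,y,z)\in\mathbb{A}^3$. Let $S_6\subset\mathbb{P}^3$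 be the surface $W^2F_3(X,Y,Z)=F_5(X,Y,Z)$, where $$F_3=(X+Y+Z)^3+(X^2Z+XY^2+YZ^2)+2XYZ,$$ $$F_5=(Z^3X^2+X^3Y^2+Y^3Z^2)-XYZ(YZ+XY+XZ).$$ It is a (geometrically) irreducible quintic. The rational map $\varphi:\mathbb{A}^3\dashrightarrow\mathbb{P}^3$, $$\varphi(x,y,z)=[-y+z-yz+xy:\ -y-z+yz+2x-xy:\ y-z-yz+xy:\ y+z-xy-yz],$$ is birational, with inverse $$\varphi^{-1}([W:X:Y:Z])=\left(\frac{(X+Z)(W+Y)}{W^2+XY+YZ+XZ},\ \frac{W+Y}{X+Y},\ \frac{(W+Z)(W+Y)}{W^2+XY+YZ+XZ}\right);$$ it restricts to an isomorphism from the open set $y(y-1)(x-z)\neq0$ of $\mathbb{A}^3$ to the open set $(W^2+XY+YZ+XZ)(X+Y)(W+Y)(W-X)\ne0$ of $\mathbb{P}^3$. Moreover: (i) The map sending the class of $(f,[0:1],[1:0],[1:1],[x:1],[y:1],[z:1])$ to $\varphi(x,y,z)$ is an isomorphism from $\mathrm M_2(6)$ to an open subset $U$ of $S_6$. Under it, $\sigma_6$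 is the restriction of the automorphism $[W:X:Y:Z]\mapsto[-W:Y:Z:X]$ of $\mathbb{P}^3$. (ii) The complement $S_6\setminus U$ is the union of the $9$ lines $$W=Z=-Y,\quad W=Y=-Z,\quad W=Y=-X,\quad W=X=-Y,\quad W=X=-Z,\quad W=Z=-X,$$ $$-X=Y=Z,\quad X=-Y=Z,\quad X=Y=-Z$$ and of the $14$ irreducible conics $$W=\pm(X+Y+Z),\ X^2+Y^2+Z^2+3(XY+XZ+YZ)=0;$$ $$W=\pm X,\ X^2+XY+3XZ-YZ=0;\qquad W=\pm Y,\ Y^2+YZ+3YX-ZX=0;\qquad W=\pm Z,\ Z^2+ZX+3ZY-XY=0;$$ $$Z=X,\ W(Y+3X)\pm X(X-Y)=0;\qquad Y=Z,\ W(X+3Z)\pm Z(Z-X)=0;\qquad X=Y,\ W(Z+3Y)\pm Y(Y-Z)=0,$$ and these $23$ curves are pairwise distinct. This complement is also the intersection of $S_6$ with the hypersurface of degree $14$ $$(W^2+XY+YZ+XZ)(W^2-X^2)(W^2-Y^2)(W^2-Z^2)(X^2-Y^2)(Y^2-Z^2)(X^2-Z^2)=0,$$ i.e. $U$ consists of the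 points $[W:X:Y:Z]\in S_6$ such that $W^2+XY+YZ+XZ\ne0$ and $W^2,X^2,Y^2,Z^2$ are pairwise distinct. -/

import Mathlib

open scoped LinearAlgebra.Projectivization MatrixGroups Topology

noncomputable section

namespace M26

universe u v w

/-! ### Varieties as spaces with functions

Varieties over a field `k` of characteristic zero are described classically, by their points over
an algebraically closed extension `K` of `k`, together with the Zariski `k`-topology and the
`K`-valued functions that are regular over `k`. -/

/-- A set with a topology and, for every open set `U`, a notion of regular function on `U`.
Functions are total; only their values on `U` matter. -/
structure FunSpace (K : Type u) (X : Type v) where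
  top : TopologicalSpace X
  regular : Set X → (X → K) → Prop

namespace FunSpace

variable {K : Type u} {X : Type v} {Y : Type w}

/-- The structure induced along an (injective) map `i : X → Y`: the topology is the induced one, and
the regular functions are locally the restrictions of regular functions on `Y`. -/
def induced (B : FunSpace K Y) (i : X → Y) : FunSpace K X where
  top := TopologicalSpace.induced i B.top
  regular U f := ∀ x ∈ U, ∃ V : Set Y, IsOpen[B.top] V ∧ i x ∈ V ∧
    ∃ g : Y → K, B.regular V g ∧ ∀ y ∈ U, i y ∈ V → f y = g (i y)

/-- The quotient structure along a (surjective) map `π : X → Y`: a set is open iff its preimage is,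
and a function is regular iff its pull-back is. For the quotient by a group this says that
the regular functions on the quotient are the invariant regular functions. -/
def quotient (A : FunSpace K X) (π : X → Y) : FunSpace K Y where
  top := TopologicalSpace.coinduced π A.top
  regular U f := A.regular (π ⁻¹' U) (f ∘ π)

/-- The bijection `e` is an isomorphism: it identifies the open sets and the regular functions. -/
def IsIso (A : FunSpace K X) (B : FunSpace K Y) (e : X ≃ Y) : Prop :=
  (∀ U : Set Y, IsOpen[A.top] (e ⁻¹' U) ↔ IsOpen[B.top] U) ∧
  ∀ U : Set Y, IsOpen[B.top] U → ∀ f : Y → K, A.regular (e ⁻¹' U) (f ∘ e) ↔ B.regular U f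

end FunSpace

section Spaces

variable (k : Type u) (K : Type v) [Field k] [Field K] [Algebra k K]

/-- Affine space with coordinates indexed by `σ`, with its Zariski `k`-topology; the regular
functions are locally quotients of polynomials with coefficients in `k`. -/
def affineSpace (σ : Type w) : FunSpace K (σ → K) where
  top := TopologicalSpace.generateFrom
    {U | ∃ q : MvPolynomial σ k, U = {x | MvPolynomial.aeval x q ≠ 0}}
  regular U f := ∀ x ∈ U, ∃ p q : MvPolynomial σ k, MvPolynomial.aeval x q ≠ 0 ∧
    ∀ y ∈ U, MvPolynomial.aeval y q ≠ 0 →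
      f y = MvPolynomial.aeval y p / MvPolynomial.aeval y q

/-- Projective space of dimension `n - 1`, as the quotient of the nonzero vectors of affine
`n`-space by scaling. -/
def projSpace (n : ℕ) : FunSpace K (ℙ K (Fin n → K)) :=
  ((affineSpace k K (Fin n)).induced
    (Subtype.val : {v : Fin n → K // v ≠ 0} → (Fin n → K))).quotient (Projectivization.mk' K)

/-- The product `ℙ⁵ × (ℙ¹)⁶`, as the quotient of the product of the spaces of nonzero vectors
by separate scalings. -/
def ambientSpace : FunSpace K (ℙ K (Fin 6 → K) × (Fin 6 → ℙ K (Fin 2 → K))) :=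
  ((affineSpace k K (Fin 6 ⊕ (Fin 6 × Fin 2))).induced
    (fun c : {a : Fin 6 → K // a ≠ 0} × (Fin 6 → {v : Fin 2 → K // v ≠ 0}) =>
      Sum.elim c.1.1 (fun ij => (c.2 ij.1).1 ij.2))).quotient
    (fun c => (Projectivization.mk' K c.1, fun i => Projectivization.mk' K (c.2 i)))

end Spaces

section Moduli

variable (K : Type v) [Field K]

/-- The map `(u, v) ↦ (a₀u² + a₁uv + a₂v², a₃u² + a₄uv + a₅v²)`. -/
def quadMap {K : Type v} [Field K] (a : Fin 6 → K) (x : Fin 2 → K) : Fin 2 → K :=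
  ![a 0 * x 0 ^ 2 + a 1 * x 0 * x 1 + a 2 * x 1 ^ 2,
    a 3 * x 0 ^ 2 + a 4 * x 0 * x 1 + a 5 * x 1 ^ 2]

/-- Endomorphisms of degree `2` of `ℙ¹` (over algebraically closed `K`): the points
`[a₀ : … : a₅]` of `ℙ⁵` for which the two quadratic forms have no common root. -/
def End2 : Set (ℙ K (Fin 6 → K)) :=
  {a | ∀ x : Fin 2 → K, x ≠ 0 → quadMap a.rep x ≠ 0}

/-- The action of an endomorphism of degree `2` on points. -/
def End2.app {K : Type v} [Field K] (f : End2 K) (x : ℙ K (Fin 2 → K)) : ℙ K (Fin 2 → K) :=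
  Projectivization.mk K (quadMap f.1.rep x.rep) (f.2 _ x.rep_nonzero)

/-- Endomorphisms `f` of degree `2` with a cycle `p₁ ↦ p₂ ↦ … ↦ p₆ ↦ p₁` of `6` distinct points,
as a subvariety of `ℙ⁵ × (ℙ¹)⁶`. The points are indexed by `Fin 6`, with cyclic addition. -/
def MTilde : Set (ℙ K (Fin 6 → K) × (Fin 6 → ℙ K (Fin 2 → K))) :=
  {m | Function.Injective m.2 ∧
    ∃ h : m.1 ∈ End2 K, ∀ i : Fin 6, End2.app ⟨m.1, h⟩ (m.2 i) = m.2 (i + 1)}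

variable {K}

/-- The endomorphism of a point of `MTilde K`. -/
def endo (m : MTilde K) : End2 K := ⟨m.1.1, m.2.2.1⟩

/-- The orbit relation of the action `ν · (f, pᵢ) = (ν f ν⁻¹, ν pᵢ)` of `PGL₂`. -/
def orbitSetoid (K : Type v) [Field K] : Setoid (MTilde K) where
  r m n := ∃ ν : PGL(Fin 2, K),
    (∀ x, End2.app (endo n) (ν • x) = ν • End2.app (endo m) x) ∧ ∀ i, n.1.2 i = ν • m.1.2 i
  iseqv :=
    { refl := fun m => ⟨1, fun x => by simp, fun i => by simp⟩
      symm := by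
        rintro m n ⟨ν, h, h'⟩
        refine ⟨ν⁻¹, fun x => ?_, fun i => ?_⟩
        · have := h (ν⁻¹ • x)
          rw [smul_inv_smul] at this
          rw [this, inv_smul_smul]
        · rw [h', inv_smul_smul]
      trans := by
        rintro m n l ⟨ν, h, h'⟩ ⟨μ, g, g'⟩
        exact ⟨μ * ν, fun x => by rw [mul_smul, g, h, mul_smul],
          fun i => by rw [g', h', mul_smul]⟩ }

variable (K) in
/-- The points of the moduli space: orbits of `PGL₂` on `MTilde K`. -/
def Moduli : Type v := Quotient (orbitSetoid K)

/-- The class of a point of `MTilde K`. -/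
def Moduli.mk (m : MTilde K) : Moduli K := Quotient.mk (orbitSetoid K) m

/-- The moduli space as the quotient variety of `MTilde K` by `PGL₂`. -/
def moduliSpace (k : Type u) (K : Type v) [Field k] [Field K] [Algebra k K] :
    FunSpace K (Moduli K) :=
  ((ambientSpace k K).induced (Subtype.val : MTilde K → _)).quotient Moduli.mk

/-- `(f, p₁, …, p₆) ↦ (f, p₂, …, p₆, p₁)`. -/
def rotate (m : MTilde K) : MTilde K :=
  ⟨(m.1.1, fun i => m.1.2 (i + 1)),
    fun i j h => by simpa using m.2.1 h, m.2.2.1, fun i => m.2.2.2 (i + 1)⟩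

/-- The automorphism of the moduli space given by rotation of the cycle. -/
def sigma6 : Moduli K → Moduli K :=
  Quotient.map' (s₁ := orbitSetoid K) (s₂ := orbitSetoid K) rotate (by
    rintro m n ⟨ν, h, h'⟩
    exact ⟨ν, h, fun i => h' (i + 1)⟩)

/-- The points `[0:1], [1:0], [1:1], [x:1], [y:1], [z:1]` of `ℙ¹`, where `t = (x, y, z)`. -/
def normalCycle (t : Fin 3 → K) (i : Fin 6) : ℙ K (Fin 2 → K) :=
  Projectivization.mk K
    ((![![0, 1], ![1, 0], ![1, 1], ![t 0, 1], ![t 1, 1], ![t 2, 1]] : Fin 6 → Fin 2 → K) i)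
    (by
      intro h
      have h0 := congrFun h 0
      have h1 := congrFun h 1
      fin_cases i <;> simp at h0 h1)

end Moduli

/-! ### The quintic surface; homogeneous coordinates are `0 = W, 1 = X, 2 = Y, 3 = Z`. -/

section Surface

open MvPolynomial

/-- `F₃ = (X+Y+Z)³ + (X²Z + XY² + YZ²) + 2XYZ`. -/
def F3 (R : Type v) [CommRing R] : MvPolynomial (Fin 4) R :=
  (X 1 + X 2 + X 3) ^ 3 + (X 1 ^ 2 * X 3 + X 1 * X 2 ^ 2 + X 2 * X 3 ^ 2) + 2 * X 1 * X 2 * X 3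

/-- `F₅ = (Z³X² + X³Y² + Y³Z²) - XYZ(YZ + XY + XZ)`. -/
def F5 (R : Type v) [CommRing R] : MvPolynomial (Fin 4) R :=
  (X 3 ^ 3 * X 1 ^ 2 + X 1 ^ 3 * X 2 ^ 2 + X 2 ^ 3 * X 3 ^ 2) -
    X 1 * X 2 * X 3 * (X 2 * X 3 + X 1 * X 2 + X 1 * X 3)

/-- `W²F₃ - F₅`. -/
def quintic (R : Type v) [CommRing R] : MvPolynomial (Fin 4) R :=
  X 0 ^ 2 * F3 R - F5 R

/-- `(W²+XY+YZ+XZ)(W²-X²)(W²-Y²)(W²-Z²)(X²-Y²)(Y²-Z²)(X²-Z²)`. -/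
def boundaryPoly (R : Type v) [CommRing R] : MvPolynomial (Fin 4) R :=
  (X 0 ^ 2 + X 1 * X 2 + X 2 * X 3 + X 1 * X 3) *
    (X 0 ^ 2 - X 1 ^ 2) * (X 0 ^ 2 - X 2 ^ 2) * (X 0 ^ 2 - X 3 ^ 2) *
    (X 1 ^ 2 - X 2 ^ 2) * (X 2 ^ 2 - X 3 ^ 2) * (X 1 ^ 2 - X 3 ^ 2)

variable {K : Type v} [Field K]

/-- The zero locus in projective space of a homogeneous polynomial. -/
def projZeros {n : ℕ} (q : MvPolynomial (Fin n) K) : Set (ℙ K (Fin n → K)) :=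
  {p | eval p.rep q = 0}

variable (K) in
/-- The quintic surface `W²F₃ = F₅` in `ℙ³`. -/
def S6 : Set (ℙ K (Fin 4 → K)) := projZeros (quintic K)

variable (K) in
/-- The pairs of linear forms cutting out the nine lines. -/
def lineEq : Fin 9 → MvPolynomial (Fin 4) K × MvPolynomial (Fin 4) K :=
  ![(X 0 - X 3, X 0 + X 2),
    (X 0 - X 2, X 0 + X 3),
    (X 0 - X 2, X 0 + X 1),
    (X 0 - X 1, X 0 + X 2),
    (X 0 - X 1, X 0 + X 3),
    (X 0 - X 3, X 0 + X 1),
    (X 2 - X 3, X 2 + X 1),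
    (X 1 - X 3, X 1 + X 2),
    (X 1 - X 2, X 1 + X 3)]

variable (K) in
/-- The linear and the quadratic forms cutting out the fourteen conics. -/
def conicEq : Fin 14 → MvPolynomial (Fin 4) K × MvPolynomial (Fin 4) K :=
  ![(X 0 - (X 1 + X 2 + X 3),
      X 1 ^ 2 + X 2 ^ 2 + X 3 ^ 2 + 3 * (X 1 * X 2 + X 1 * X 3 + X 2 * X 3)),
    (X 0 + (X 1 + X 2 + X 3),
      X 1 ^ 2 + X 2 ^ 2 + X 3 ^ 2 + 3 * (X 1 * X 2 + X 1 * X 3 + X 2 * X 3)),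
    (X 0 - X 1, X 1 ^ 2 + X 1 * X 2 + 3 * X 1 * X 3 - X 2 * X 3),
    (X 0 + X 1, X 1 ^ 2 + X 1 * X 2 + 3 * X 1 * X 3 - X 2 * X 3),
    (X 0 - X 2, X 2 ^ 2 + X 2 * X 3 + 3 * X 2 * X 1 - X 3 * X 1),
    (X 0 + X 2, X 2 ^ 2 + X 2 * X 3 + 3 * X 2 * X 1 - X 3 * X 1),
    (X 0 - X 3, X 3 ^ 2 + X 3 * X 1 + 3 * X 3 * X 2 - X 1 * X 2),
    (X 0 + X 3, X 3 ^ 2 + X 3 * X 1 + 3 * X 3 * X 2 - X 1 * X 2),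
    (X 3 - X 1, X 0 * (X 2 + 3 * X 1) + X 1 * (X 1 - X 2)),
    (X 3 - X 1, X 0 * (X 2 + 3 * X 1) - X 1 * (X 1 - X 2)),
    (X 2 - X 3, X 0 * (X 1 + 3 * X 3) + X 3 * (X 3 - X 1)),
    (X 2 - X 3, X 0 * (X 1 + 3 * X 3) - X 3 * (X 3 - X 1)),
    (X 1 - X 2, X 0 * (X 3 + 3 * X 2) + X 2 * (X 2 - X 3)),
    (X 1 - X 2, X 0 * (X 3 + 3 * X 2) - X 2 * (X 2 - X 3))]

variable (K) in
/-- The lines `L₁, …, L₉`. -/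
def lineCurve (i : Fin 9) : Set (ℙ K (Fin 4 → K)) :=
  projZeros (lineEq K i).1 ∩ projZeros (lineEq K i).2

variable (K) in
/-- The conics `C₁, …, C₁₄`. -/
def conicCurve (i : Fin 14) : Set (ℙ K (Fin 4 → K)) :=
  projZeros (conicEq K i).1 ∩ projZeros (conicEq K i).2

/-- A line in `ℙ³`: the image of `ℙ¹` under an injective linear map. -/
def IsLine (L : Set (ℙ K (Fin 4 → K))) : Prop :=
  ∃ (l : (Fin 2 → K) →ₗ[K] (Fin 4 → K)) (hl : Function.Injective l),
    L = Set.range (Projectivization.map l hl)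

/-- A conic in `ℙ³`: the image of an irreducible plane conic under a linear embedding of `ℙ²`. -/
def IsConic (C : Set (ℙ K (Fin 4 → K))) : Prop :=
  ∃ (l : (Fin 3 → K) →ₗ[K] (Fin 4 → K)) (hl : Function.Injective l)
    (q : MvPolynomial (Fin 3) K), q.IsHomogeneous 2 ∧ Irreducible q ∧
    C = Projectivization.map l hl '' projZeros q

/-- The linear map `(W, X, Y, Z) ↦ (-W, Y, Z, X)`. -/
def tauLin : (Fin 4 → K) →ₗ[K] (Fin 4 → K) where
  toFun v := ![-v 0, v 2, v 3, v 1]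
  map_add' v w := by ext i; fin_cases i <;> simp [add_comm]
  map_smul' c v := by ext i; fin_cases i <;> simp

theorem tauLin_injective : Function.Injective (tauLin (K := K)) := by
  intro v w h
  have h0 := congrFun h 0
  have h1 := congrFun h 1
  have h2 := congrFun h 2
  have h3 := congrFun h 3
  simp [tauLin] at h0 h1 h2 h3
  ext i
  fin_cases i <;> simp [*]

/-- The automorphism `[W : X : Y : Z] ↦ [-W : Y : Z : X]` of `ℙ³`. -/
def tau : ℙ K (Fin 4 → K) → ℙ K (Fin 4 → K) := Projectivization.map tauLin tauLin_injective

/-- Homogeneous coordinates of the rational map `φ : 𝔸³ ⇢ ℙ³`, with `t = (x, y, z)`. -/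
def phi (t : Fin 3 → K) : Fin 4 → K :=
  ![-t 1 + t 2 - t 1 * t 2 + t 0 * t 1,
    -t 1 - t 2 + t 1 * t 2 + 2 * t 0 - t 0 * t 1,
    t 1 - t 2 - t 1 * t 2 + t 0 * t 1,
    t 1 + t 2 - t 0 * t 1 - t 1 * t 2]

/-- The quadratic form `W² + XY + YZ + XZ`. -/
def quadForm (v : Fin 4 → K) : K := v 0 ^ 2 + v 1 * v 2 + v 2 * v 3 + v 1 * v 3

/-- The inverse rational map `ψ : ℙ³ ⇢ 𝔸³`, in homogeneous coordinates `v = (W, X, Y, Z)`. -/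
def psi (v : Fin 4 → K) : Fin 3 → K :=
  ![(v 1 + v 3) * (v 0 + v 2) / quadForm v,
    (v 0 + v 2) / (v 1 + v 2),
    (v 0 + v 3) * (v 0 + v 2) / quadForm v]

variable (K) in
/-- The open subset of `𝔸³` where `y(y-1)(x-z) ≠ 0`. -/
def affineDomain : Set (Fin 3 → K) := {t | t 1 * (t 1 - 1) * (t 0 - t 2) ≠ 0}

variable (K) in
/-- The open subset of `ℙ³` where `(W²+XY+YZ+XZ)(X+Y)(W+Y)(W-X) ≠ 0`. -/
def projDomain : Set (ℙ K (Fin 4 → K)) :=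
  {p | quadForm p.rep * (p.rep 1 + p.rep 2) * (p.rep 0 + p.rep 2) * (p.rep 0 - p.rep 1) ≠ 0}

end Surface

end M26

end

open M26

/-!
Moving `p₁, p₂, p₃` to `0, ∞, 1` by `PGL₂` leaves the cross-ratios `x, y, z` of these points with
`p₄, p₅, p₆` as coordinates on the moduli space. A quadratic map with `0 ↦ ∞ ↦ 1` and `z ↦ 0` has
the form `[s u² + (c - s z) u v - z c v² : s u² + d u v]`, and the remaining conditions
`1 ↦ x ↦ y ↦ z` are three linear equations in `(s, c, d)`. Their determinant cuts out the surface of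
normal forms; up to the factors which vanish outside `affineDomain`, it is the equation of the
quintic composed with `φ`. For points of this surface, the solution defines an endomorphism with the
given cycle exactly when no factor of the boundary polynomial vanishes at `φ(x, y, z)`.

The resulting bijection is regular since cross-ratios are, and so is its inverse since the
coefficients of the solution are polynomials in `x, y, z`. The equation of the quintic factors on
each component of the boundary hypersurface, which gives the lines and conics.
-/

noncomputable section

namespace M26

namespace FunSpace

variable {k K X Y Z : Type*}

section Morphisms

/-- Morphisms of spaces with functions: continuous maps along which regular functions pull back to
regular functions. -/
structure Hom (A : FunSpace K X) (B : FunSpace K Y) (f : X → Y) : Prop where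
  isOpen_preimage : ∀ U, IsOpen[B.top] U → IsOpen[A.top] (f ⁻¹' U)
  regular_comp : ∀ U, IsOpen[B.top] U → ∀ g, B.regular U g → A.regular (f ⁻¹' U) (g ∘ f)

variable {A : FunSpace K X} {B : FunSpace K Y} {C : FunSpace K Z}

theorem Hom.comp {f : X → Y} {g : Y → Z} (hg : Hom B C g) (hf : Hom A B f) : Hom A C (g ∘ f) where
  isOpen_preimage U hU := hf.isOpen_preimage _ (hg.isOpen_preimage U hU)
  regular_comp U hU h hh :=
    hf.regular_comp _ (hg.isOpen_preimage U hU) _ (hg.regular_comp U hU h hh)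

theorem isIso_of_hom {e : X ≃ Y} (h : Hom A B e) (h' : Hom B A e.symm) : IsIso A B e := by
  refine ⟨fun U => ⟨fun hU => ?_, h.isOpen_preimage U⟩, fun U hU f => ⟨fun hf => ?_,
    h.regular_comp U hU f⟩⟩
  · simpa only [e.symm_preimage_preimage] using h'.isOpen_preimage _ hU
  · simpa only [e.symm_preimage_preimage, Function.comp_assoc, e.self_comp_symm,
      Function.comp_id] using h'.regular_comp _ (h.isOpen_preimage U hU) _ hf

theorem hom_induced (B : FunSpace K Y) (i : X → Y) : Hom (B.induced i) B i where
  isOpen_preimage U hU := ⟨U, hU, rfl⟩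
  regular_comp U hU g hg _ hx := ⟨U, hU, hx, g, hg, fun _ _ _ => rfl⟩

theorem hom_quotient (A : FunSpace K X) (π : X → Y) : Hom A (A.quotient π) π where
  isOpen_preimage _ hU := hU
  regular_comp _ _ _ hg := hg

theorem Hom.of_comp_quotient {π : X → Y} {f : Y → Z} (h : Hom A C (f ∘ π)) :
    Hom (A.quotient π) C f where
  isOpen_preimage := h.isOpen_preimage
  regular_comp := h.regular_comp

theorem isOpen_of_forall_mem {U : Set X} (h : ∀ x ∈ U, ∃ V, IsOpen[A.top] V ∧ x ∈ V ∧ V ⊆ U) :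
    IsOpen[A.top] U := by
  let := A.top
  refine isOpen_iff_forall_mem_open.2 fun x hx => ?_
  obtain ⟨V, hV, hxV, hVU⟩ := h x hx
  exact ⟨V, hVU, hV, hxV⟩

theorem isOpen_inter {U V : Set X} (hU : IsOpen[A.top] U) (hV : IsOpen[A.top] V) :
    IsOpen[A.top] (U ∩ V) :=
  @IsOpen.inter _ A.top _ _ hU hV

theorem isOpen_univ (A : FunSpace K X) : IsOpen[A.top] Set.univ :=
  @_root_.isOpen_univ _ A.top

theorem Hom.regular {f : X → Y} (hf : Hom A B f) {g : Y → K} (hg : B.regular Set.univ g) :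
    A.regular Set.univ fun x => g (f x) :=
  hf.regular_comp _ B.isOpen_univ g hg

end Morphisms

variable [Field k] [Field K] [Algebra k K]

/-- The regular functions form a sheaf of `k`-algebras, and a regular function does not vanish on
an open set, where it is invertible. The axiom `congr` is needed because functions are total and
only their values on `U` matter. -/
structure IsLocallyRinged (k : Type*) [Field k] [Algebra k K] (A : FunSpace K X) : Prop where
  congr : ∀ {U : Set X} {f g : X → K}, Set.EqOn f g U → A.regular U f → A.regular U g
  mono : ∀ {U V : Set X} {f : X → K}, V ⊆ U → A.regular U f → A.regular V f
  locality : ∀ {U : Set X} {f : X → K},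
    (∀ x ∈ U, ∃ V, IsOpen[A.top] V ∧ x ∈ V ∧ A.regular (U ∩ V) f) → A.regular U f
  const : ∀ (U : Set X) (c : k), A.regular U fun _ => algebraMap k K c
  add : ∀ {U : Set X} {f g : X → K}, A.regular U f → A.regular U g →
    A.regular U fun x => f x + g x
  mul : ∀ {U : Set X} {f g : X → K}, A.regular U f → A.regular U g →
    A.regular U fun x => f x * g x
  inv : ∀ {U : Set X} {f : X → K}, A.regular U f → (∀ x ∈ U, f x ≠ 0) →
    A.regular U fun x => (f x)⁻¹
  isOpen_ne : ∀ {U : Set X} {f : X → K}, IsOpen[A.top] U → A.regular U f →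
    IsOpen[A.top] {x | x ∈ U ∧ f x ≠ 0}

namespace IsLocallyRinged

variable {A : FunSpace K X} {U : Set X} {f g : X → K}

theorem div (hA : IsLocallyRinged k A) (hf : A.regular U f) (hg : A.regular U g)
    (h : ∀ x ∈ U, g x ≠ 0) : A.regular U fun x => f x / g x := by
  simpa only [div_eq_mul_inv] using hA.mul hf (hA.inv hg h)

theorem regular_aeval (hA : IsLocallyRinged k A) {σ : Type*} {c : X → σ → K}
    (hc : ∀ i, A.regular U fun x => c x i) (q : MvPolynomial σ k) :
    A.regular U fun x => MvPolynomial.aeval (c x) q := by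
  induction q using MvPolynomial.induction_on with
  | C a => simpa only [MvPolynomial.aeval_C] using hA.const U a
  | add p q hp hq => simpa only [map_add] using hA.add hp hq
  | mul_X p i hp => simpa only [map_mul, MvPolynomial.aeval_X] using hA.mul hp (hc i)

theorem regular_of_eq_aeval (hA : IsLocallyRinged k A) {σ : Type*} {c : X → σ → K}
    (hc : ∀ i, A.regular U fun x => c x i) (q : MvPolynomial σ k)
    (hq : ∀ x, f x = MvPolynomial.aeval (c x) q) : A.regular U f :=
  hA.congr (fun x _ => (hq x).symm) (hA.regular_aeval hc q)

theorem regular_extend (hA : IsLocallyRinged k A) {i : Y → X} (hi : Function.Injective i)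
    {V : Set Y} {g : Y → K} (hg : (A.induced i).regular V g) :
    A.regular (i '' V) (Function.extend i g 0) := by
  refine hA.locality ?_
  rintro _ ⟨y, hy, rfl⟩
  obtain ⟨W, hW, hyW, r, hr, hgr⟩ := hg y hy
  refine ⟨W, hW, hyW, hA.congr ?_ (hA.mono Set.inter_subset_right hr)⟩
  rintro _ ⟨⟨z, hz, rfl⟩, hzW⟩
  rw [hi.extend_apply, hgr z hz hzW]

end IsLocallyRinged

section Induced

variable {B : FunSpace K Y} {i : X → Y} {U : Set X} {f g : X → K}

theorem IsLocallyRinged.regular_induced_of_locally (hB : IsLocallyRinged k B)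
    (h : ∀ x ∈ U, ∃ V, IsOpen[(B.induced i).top] V ∧ x ∈ V ∧ (B.induced i).regular (U ∩ V) f) :
    (B.induced i).regular U f := by
  intro x hx
  obtain ⟨_, ⟨V, hV, rfl⟩, hxV, hf⟩ := h x hx
  obtain ⟨V', hV', hxV', r, hr, hfr⟩ := hf x ⟨hx, hxV⟩
  exact ⟨V' ∩ V, isOpen_inter hV' hV, ⟨hxV', hxV⟩, r, hB.mono Set.inter_subset_left hr,
    fun y hy hyV => hfr y ⟨hy, hyV.2⟩ hyV.1⟩

theorem IsLocallyRinged.regular_induced_map₂ (hB : IsLocallyRinged k B) (op : K → K → K)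
    (hop : ∀ {V : Set Y} {r s : Y → K}, B.regular V r → B.regular V s →
      B.regular V fun y => op (r y) (s y))
    (hf : (B.induced i).regular U f) (hg : (B.induced i).regular U g) :
    (B.induced i).regular U fun x => op (f x) (g x) := by
  intro x hx
  obtain ⟨V, hV, hxV, r, hr, hfr⟩ := hf x hx
  obtain ⟨W, hW, hxW, s, hs, hgs⟩ := hg x hx
  refine ⟨V ∩ W, isOpen_inter hV hW, ⟨hxV, hxW⟩, _,
    hop (hB.mono Set.inter_subset_left hr) (hB.mono Set.inter_subset_right hs),
    fun y hy hyV => ?_⟩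
  beta_reduce
  rw [hfr y hy hyV.1, hgs y hy hyV.2]

theorem IsLocallyRinged.regular_induced_inv (hB : IsLocallyRinged k B)
    (hf : (B.induced i).regular U f) (hf0 : ∀ x ∈ U, f x ≠ 0) :
    (B.induced i).regular U fun x => (f x)⁻¹ := by
  intro x hx
  obtain ⟨V, hV, hxV, r, hr, hfr⟩ := hf x hx
  refine ⟨{y | y ∈ V ∧ r y ≠ 0}, hB.isOpen_ne hV hr, ⟨hxV, hfr x hx hxV ▸ hf0 x hx⟩, _,
    hB.inv (hB.mono (fun y hy => hy.1) hr) fun y hy => hy.2, fun y hy hyV => ?_⟩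
  beta_reduce
  rw [hfr y hy hyV.1]

theorem IsLocallyRinged.isOpen_induced_ne (hB : IsLocallyRinged k B)
    (hU : IsOpen[(B.induced i).top] U) (hf : (B.induced i).regular U f) :
    IsOpen[(B.induced i).top] {x | x ∈ U ∧ f x ≠ 0} := by
  obtain ⟨W, hW, rfl⟩ := hU
  refine isOpen_of_forall_mem fun x ⟨hx, hfx⟩ => ?_
  obtain ⟨V, hV, hxV, r, hr, hfr⟩ := hf x hx
  refine ⟨_, ⟨W ∩ {y | y ∈ V ∧ r y ≠ 0}, isOpen_inter hW (hB.isOpen_ne hV hr), rfl⟩,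
    ⟨hx, hxV, hfr x hx hxV ▸ hfx⟩, fun y hy => ⟨hy.1, ?_⟩⟩
  rw [hfr y hy.1 hy.2.1]
  exact hy.2.2

theorem IsLocallyRinged.induced (hB : IsLocallyRinged k B) (i : X → Y) :
    IsLocallyRinged k (B.induced i) where
  congr hfg hf x hx :=
    let ⟨V, hV, hxV, r, hr, hfr⟩ := hf x hx
    ⟨V, hV, hxV, r, hr, fun y hy hyV => hfg hy ▸ hfr y hy hyV⟩
  mono hUV hf x hx :=
    let ⟨V, hV, hxV, r, hr, hfr⟩ := hf x (hUV hx)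
    ⟨V, hV, hxV, r, hr, fun y hy => hfr y (hUV hy)⟩
  locality := hB.regular_induced_of_locally
  const _ c _ _ := ⟨Set.univ, B.isOpen_univ, trivial, _, hB.const _ c, fun _ _ _ => rfl⟩
  add := hB.regular_induced_map₂ (· + ·) hB.add
  mul := hB.regular_induced_map₂ (· * ·) hB.mul
  inv := hB.regular_induced_inv
  isOpen_ne := hB.isOpen_induced_ne

theorem IsLocallyRinged.quotient {A : FunSpace K X} (hA : IsLocallyRinged k A) (π : X → Y) :
    IsLocallyRinged k (A.quotient π) where
  congr h hf := hA.congr (fun _ hx => h hx) hf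
  mono h hf := hA.mono (Set.preimage_mono h) hf
  locality h := hA.locality fun x hx =>
    let ⟨V, hV, hxV, hf⟩ := h (π x) hx
    ⟨π ⁻¹' V, hV, hxV, hf⟩
  const _ c := hA.const _ c
  add hf hg := hA.add hf hg
  mul hf hg := hA.mul hf hg
  inv hf h := hA.inv hf fun x hx => h (π x) hx
  isOpen_ne hU hf := hA.isOpen_ne hU hf

theorem Hom.into_induced {A : FunSpace K X} (hA : IsLocallyRinged k A) {B : FunSpace K Z}
    {i : Y → Z} {f : X → Y} (h : Hom A B (i ∘ f)) : Hom A (B.induced i) f where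
  isOpen_preimage := by
    rintro _ ⟨U, hU, rfl⟩
    exact h.isOpen_preimage U hU
  regular_comp U _ g hg := by
    refine hA.locality fun x hx => ?_
    obtain ⟨V, hV, hxV, r, hr, hgr⟩ := hg (f x) hx
    exact ⟨_, h.isOpen_preimage V hV, hxV, hA.congr (fun y hy => (hgr (f y) hy.1 hy.2).symm)
      (hA.mono Set.inter_subset_right (h.regular_comp V hV r hr))⟩

theorem hom_induced_quotient {A : FunSpace K X} (hA : IsLocallyRinged k A) {π : X → Y} {S : Set Y}
    (hS : IsOpen[A.top] (π ⁻¹' S)) :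
    Hom ((A.quotient π).induced (Subtype.val : S → Y))
      ((A.induced (Subtype.val : π ⁻¹' S → X)).quotient (S.restrictPreimage π)) id := by
  have isOpen_image : ∀ V : Set S,
      IsOpen[(A.induced (Subtype.val : π ⁻¹' S → X)).top] (S.restrictPreimage π ⁻¹' V) →
      IsOpen[(A.quotient π).top] (Subtype.val '' V) := by
    rintro V ⟨W, hW, hWV⟩
    change IsOpen[A.top] (π ⁻¹' (Subtype.val '' V))
    rw [← Set.image_val_preimage_restrictPreimage, ← hWV, Subtype.image_preimage_coe]
    exact isOpen_inter hS hW
  refine ⟨fun V hV => ⟨_, isOpen_image V hV, Set.preimage_image_eq _ Subtype.val_injective⟩,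
    fun V hV g hg y hy => ⟨_, isOpen_image V hV, ⟨y, hy, rfl⟩, Function.extend Subtype.val g 0,
      ?_, fun z _ _ => (Subtype.val_injective.extend_apply ..).symm⟩⟩
  change A.regular (π ⁻¹' (Subtype.val '' V)) _
  rw [← Set.image_val_preimage_restrictPreimage]
  refine hA.congr ?_ (hA.regular_extend Subtype.val_injective hg)
  rintro _ ⟨x, -, rfl⟩
  rw [Subtype.val_injective.extend_apply]
  exact (Subtype.val_injective.extend_apply g 0 (S.restrictPreimage π x)).symm

theorem Hom.of_comp_quotient_restrict {A : FunSpace K X} (hA : IsLocallyRinged k A)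
    {B : FunSpace K Z} {π : X → Y} {S : Set Y} (hS : IsOpen[A.top] (π ⁻¹' S)) {f : S → Z}
    (h : Hom (A.induced (Subtype.val : π ⁻¹' S → X)) B (f ∘ S.restrictPreimage π)) :
    Hom ((A.quotient π).induced (Subtype.val : S → Y)) B f :=
  h.of_comp_quotient.comp (hom_induced_quotient hA hS)

end Induced

section AffineSpace

open MvPolynomial

variable {σ : Type*} {U : Set (σ → K)} {f g : (σ → K) → K}

theorem exists_aeval_ne_zero {V : Set (σ → K)} (hV : IsOpen[(affineSpace k K σ).top] V) {x : σ → K}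
    (hx : x ∈ V) : ∃ q : MvPolynomial σ k, aeval x q ≠ 0 ∧ ∀ y, aeval y q ≠ 0 → y ∈ V := by
  induction hV with
  | basic V hV =>
    obtain ⟨q, rfl⟩ := hV
    exact ⟨q, hx, fun y hy => hy⟩
  | univ => exact ⟨1, by rw [map_one]; exact one_ne_zero, fun _ _ => trivial⟩
  | inter V W _ _ hV hW =>
    obtain ⟨q, hq, hq'⟩ := hV hx.1
    obtain ⟨r, hr, hr'⟩ := hW hx.2
    refine ⟨q * r, by rw [map_mul]; exact mul_ne_zero hq hr, fun y hy => ?_⟩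
    rw [map_mul] at hy
    exact ⟨hq' y (left_ne_zero_of_mul hy), hr' y (right_ne_zero_of_mul hy)⟩
  | sUnion S _ h =>
    obtain ⟨V, hVS, hxV⟩ := hx
    obtain ⟨q, hq, hq'⟩ := h V hVS hxV
    exact ⟨q, hq, fun y hy => ⟨V, hVS, hq' y hy⟩⟩

theorem isOpen_aeval_ne_zero (q : MvPolynomial σ k) :
    IsOpen[(affineSpace k K σ).top] {x | aeval x q ≠ 0} :=
  TopologicalSpace.GenerateOpen.basic _ ⟨q, rfl⟩

theorem regular_affineSpace_of_locally
    (h : ∀ x ∈ U, ∃ V, IsOpen[(affineSpace k K σ).top] V ∧ x ∈ V ∧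
      (affineSpace k K σ).regular (U ∩ V) f) : (affineSpace k K σ).regular U f := by
  intro x hx
  obtain ⟨V, hV, hxV, hf⟩ := h x hx
  obtain ⟨p, q, hq, e⟩ := hf x ⟨hx, hxV⟩
  obtain ⟨r, hr, hr'⟩ := exists_aeval_ne_zero hV hxV
  refine ⟨p * r, q * r, by rw [map_mul]; exact mul_ne_zero hq hr, fun y hy hyq => ?_⟩
  obtain ⟨hyq, hyr⟩ := mul_ne_zero_iff.1 (map_mul (aeval y) q r ▸ hyq)
  rw [e y ⟨hy, hr' y hyr⟩ hyq, map_mul, map_mul, mul_div_mul_right _ _ hyr]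

theorem regular_affineSpace_add (hf : (affineSpace k K σ).regular U f)
    (hg : (affineSpace k K σ).regular U g) : (affineSpace k K σ).regular U fun x => f x + g x := by
  intro x hx
  obtain ⟨p, q, hq, hfpq⟩ := hf x hx
  obtain ⟨r, s, hs, hgrs⟩ := hg x hx
  refine ⟨p * s + q * r, q * s, by rw [map_mul]; exact mul_ne_zero hq hs, fun y hy hyqs => ?_⟩
  obtain ⟨hyq, hys⟩ := mul_ne_zero_iff.1 (map_mul (aeval y) q s ▸ hyqs)
  beta_reduce
  rw [hfpq y hy hyq, hgrs y hy hys, div_add_div _ _ hyq hys, map_add, map_mul, map_mul, map_mul]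

theorem regular_affineSpace_mul (hf : (affineSpace k K σ).regular U f)
    (hg : (affineSpace k K σ).regular U g) : (affineSpace k K σ).regular U fun x => f x * g x := by
  intro x hx
  obtain ⟨p, q, hq, hfpq⟩ := hf x hx
  obtain ⟨r, s, hs, hgrs⟩ := hg x hx
  refine ⟨p * r, q * s, by rw [map_mul]; exact mul_ne_zero hq hs, fun y hy hyqs => ?_⟩
  obtain ⟨hyq, hys⟩ := mul_ne_zero_iff.1 (map_mul (aeval y) q s ▸ hyqs)
  beta_reduce
  rw [hfpq y hy hyq, hgrs y hy hys, div_mul_div_comm, map_mul, map_mul]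

theorem regular_affineSpace_inv (hf : (affineSpace k K σ).regular U f) (hf0 : ∀ x ∈ U, f x ≠ 0) :
    (affineSpace k K σ).regular U fun x => (f x)⁻¹ := by
  intro x hx
  obtain ⟨p, q, hq, hfpq⟩ := hf x hx
  have hp : aeval x p ≠ 0 := (div_ne_zero_iff.1 (hfpq x hx hq ▸ hf0 x hx)).1
  refine ⟨q * q, p * q, by rw [map_mul]; exact mul_ne_zero hp hq, fun y hy hypq => ?_⟩
  obtain ⟨-, hyq⟩ := mul_ne_zero_iff.1 (map_mul (aeval y) p q ▸ hypq)
  beta_reduce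
  rw [hfpq y hy hyq, inv_div, map_mul, map_mul, mul_div_mul_right _ _ hyq]

theorem isOpen_affineSpace_ne (hU : IsOpen[(affineSpace k K σ).top] U)
    (hf : (affineSpace k K σ).regular U f) :
    IsOpen[(affineSpace k K σ).top] {x | x ∈ U ∧ f x ≠ 0} := by
  refine isOpen_of_forall_mem fun x ⟨hx, hfx⟩ => ?_
  obtain ⟨p, q, hq, hfpq⟩ := hf x hx
  obtain ⟨r, hr, hr'⟩ := exists_aeval_ne_zero hU hx
  have hp : aeval x p ≠ 0 := (div_ne_zero_iff.1 (hfpq x hx hq ▸ hfx)).1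
  refine ⟨_, isOpen_aeval_ne_zero (p * q * r),
    by simpa only [map_mul, Set.mem_ofPred_eq] using mul_ne_zero (mul_ne_zero hp hq) hr,
    fun y hy => ?_⟩
  simp only [map_mul, ne_eq, mul_eq_zero, not_or, Set.mem_ofPred_eq] at hy
  exact ⟨hr' y hy.2, hfpq y (hr' y hy.2) hy.1.2 ▸ div_ne_zero hy.1.1 hy.1.2⟩

variable (k K σ) in
theorem isLocallyRinged_affineSpace : IsLocallyRinged k (affineSpace k K σ) where
  congr hfg hf x hx :=
    let ⟨p, q, hq, hfpq⟩ := hf x hx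
    ⟨p, q, hq, fun y hy hyq => hfg hy ▸ hfpq y hy hyq⟩
  mono hUV hf x hx :=
    let ⟨p, q, hq, hfpq⟩ := hf x (hUV hx)
    ⟨p, q, hq, fun y hy => hfpq y (hUV hy)⟩
  locality := regular_affineSpace_of_locally
  const _ c _ _ := ⟨C c, 1, by simp, by simp⟩
  add := regular_affineSpace_add
  mul := regular_affineSpace_mul
  inv := regular_affineSpace_inv
  isOpen_ne := isOpen_affineSpace_ne

theorem Hom.into_affineSpace {A : FunSpace K X} (hA : IsLocallyRinged k A) {f : X → σ → K}
    (hf : ∀ i, A.regular Set.univ fun x => f x i) : Hom A (affineSpace k K σ) f where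
  isOpen_preimage U hU := by
    refine isOpen_of_forall_mem fun x hx => ?_
    obtain ⟨q, hq, hq'⟩ := exists_aeval_ne_zero hU hx
    exact ⟨_, hA.isOpen_ne A.isOpen_univ (hA.regular_aeval hf q), ⟨trivial, hq⟩,
      fun y hy => hq' _ hy.2⟩
  regular_comp U _ g hg := by
    refine hA.locality fun x hx => ?_
    obtain ⟨p, q, hq, hgpq⟩ := hg (f x) hx
    exact ⟨_, hA.isOpen_ne A.isOpen_univ (hA.regular_aeval hf q), ⟨trivial, hq⟩,
      hA.congr (fun y hy => (hgpq (f y) hy.1 hy.2.2).symm) (hA.div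
        (hA.mono (Set.subset_univ _) (hA.regular_aeval hf p))
        (hA.mono (Set.subset_univ _) (hA.regular_aeval hf q)) fun y hy => hy.2.2)⟩

theorem Hom.regular_coord {A : FunSpace K X} {f : X → σ → K} (hf : Hom A (affineSpace k K σ) f)
    (i : σ) : A.regular Set.univ fun x => f x i :=
  hf.regular (g := fun x => x i) fun _ _ => ⟨MvPolynomial.X i, 1, by simp, by simp⟩

end AffineSpace

end FunSpace

section Irreducibility

section QuadraticPolynomial

open Polynomial

variable {R : Type*} [CommRing R]

theorem isSquare_neg_mul_of_quadratic_eq_mul {a b : R} {f g : R[X]} (hf : f.natDegree = 1)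
    (hg : g.natDegree = 1) (h : C a * X ^ 2 + C b = f * g) : IsSquare (-(a * b)) := by
  obtain ⟨p, q, rfl⟩ := exists_eq_X_add_C_of_natDegree_le_one hf.le
  obtain ⟨s, t, rfl⟩ := exists_eq_X_add_C_of_natDegree_le_one hg.le
  have hmul : (C p * X + C q) * (C s * X + C t) =
      C (p * s) * X ^ 2 + C (p * t + q * s) * X + C (q * t) := by
    simp only [map_add, map_mul]
    ring
  have hcoeff (n : ℕ) := congrArg (fun r => r.coeff n) (h.trans hmul)
  have h0 : b = q * t := by simpa [coeff_X] using hcoeff 0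
  have h1 : 0 = p * t + q * s := by simpa [coeff_X, coeff_C, -map_mul] using hcoeff 1
  have h2 : a = p * s := by simpa [coeff_X, coeff_C, -map_mul] using hcoeff 2
  exact ⟨p * t, by linear_combination (-b) * h2 - p * s * h0 + p * t * h1⟩

variable [IsDomain R]

theorem isUnit_of_isUnit_map_of_dvd_monic {S : Type*} [CommRing S] [IsDomain S] (φ : R →+* S)
    {p q : R[X]} (hq : q.Monic) (hpq : p ∣ q) (hp : IsUnit (p.map φ)) : IsUnit p := by
  have hu : IsUnit p.leadingCoeff := hq.isUnit_leadingCoeff_of_dvd hpq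
  have hd : p.degree = 0 := by
    rw [← degree_map_eq_of_isUnit_leadingCoeff φ hu, degree_eq_zero_of_isUnit hp]
  rw [eq_C_of_degree_eq_zero hd, leadingCoeff_C] at hu
  rw [eq_C_of_degree_eq_zero hd]
  exact isUnit_C.2 hu

theorem irreducible_quadratic_of_not_isSquare {a b : R} (hab : IsRelPrime a b)
    (hsq : ¬ IsSquare (-(a * b))) : Irreducible (C a * X ^ 2 + C b) := by
  have ha : a ≠ 0 := by
    rintro rfl
    simp at hsq
  have hdeg : (C a * X ^ 2 + C b).natDegree = 2 := by
    simpa using natDegree_quadratic (b := 0) (c := b) ha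
  have h0 : C a * X ^ 2 + C b ≠ 0 := ne_zero_of_natDegree_gt (hdeg ▸ two_pos)
  have isUnit_of_dvd : ∀ f, f ∣ C a * X ^ 2 + C b → f.natDegree = 0 → IsUnit f := by
    intro f hf hf0
    obtain ⟨r, rfl⟩ := natDegree_eq_zero.1 hf0
    rw [C_dvd_iff_dvd_coeff] at hf
    exact isUnit_C.2 (hab (by simpa [coeff_C] using hf 2) (by simpa using hf 0))
  refine ⟨fun h => by simp [natDegree_eq_zero_of_isUnit h] at hdeg, fun f g hfg => ?_⟩
  have hfg0 : f ≠ 0 ∧ g ≠ 0 := mul_ne_zero_iff.1 (hfg ▸ h0)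
  rw [hfg, natDegree_mul hfg0.1 hfg0.2] at hdeg
  by_contra! h
  have hf : f.natDegree ≠ 0 := fun hf => h.1 (isUnit_of_dvd f ⟨g, hfg⟩ hf)
  have hg : g.natDegree ≠ 0 := fun hg => h.2 (isUnit_of_dvd g ⟨f, by rw [hfg, mul_comm]⟩ hg)
  exact hsq (isSquare_neg_mul_of_quadratic_eq_mul (by lia) (by lia) hfg)

end QuadraticPolynomial

open MvPolynomial

variable (R : Type*) [CommRing R]

theorem F3_isHomogeneous : (F3 R).IsHomogeneous 3 := by
  have h (i : Fin 4) : (X i : MvPolynomial (Fin 4) R).IsHomogeneous 1 := isHomogeneous_X R i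
  have h2 : (2 : MvPolynomial (Fin 4) R).IsHomogeneous 0 := isHomogeneous_C _ (2 : R)
  refine ((((h 1).add (h 2)).add (h 3)).pow 3).add (((((h 1).pow 2).mul (h 3)).add
    ((h 1).mul ((h 2).pow 2))).add ((h 2).mul ((h 3).pow 2))) |>.add ?_
  exact ((h2.mul (h 1)).mul (h 2)).mul (h 3)

theorem F5_isHomogeneous : (F5 R).IsHomogeneous 5 := by
  have h (i : Fin 4) : (X i : MvPolynomial (Fin 4) R).IsHomogeneous 1 := isHomogeneous_X R i
  refine (((((h 3).pow 3).mul ((h 1).pow 2)).add (((h 1).pow 3).mul ((h 2).pow 2))).add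
    (((h 2).pow 3).mul ((h 3).pow 2))).sub ?_
  exact (((h 1).mul (h 2)).mul (h 3)).mul ((((h 2).mul (h 3)).add ((h 1).mul (h 2))).add
    ((h 1).mul (h 3)))

theorem quintic_isHomogeneous : (quintic R).IsHomogeneous 5 :=
  (((isHomogeneous_X R 0).pow 2).mul (F3_isHomogeneous R)).sub (F5_isHomogeneous R)

/-- `F₃` as a polynomial in the three variables `X, Y, Z`. -/
def cubicXYZ : MvPolynomial (Fin 3) R :=
  (X 0 + X 1 + X 2) ^ 3 + (X 0 ^ 2 * X 2 + X 0 * X 1 ^ 2 + X 1 * X 2 ^ 2) + 2 * X 0 * X 1 * X 2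

/-- `F₅` as a polynomial in the three variables `X, Y, Z`. -/
def quinticXYZ : MvPolynomial (Fin 3) R :=
  (X 2 ^ 3 * X 0 ^ 2 + X 0 ^ 3 * X 1 ^ 2 + X 1 ^ 3 * X 2 ^ 2) -
    X 0 * X 1 * X 2 * (X 1 * X 2 + X 0 * X 1 + X 0 * X 2)

theorem finSuccEquiv_quintic :
    finSuccEquiv R 3 (quintic R) =
      Polynomial.C (cubicXYZ R) * Polynomial.X ^ 2 + Polynomial.C (-quinticXYZ R) := by
  have e0 : finSuccEquiv R 3 (X 0) = Polynomial.X := finSuccEquiv_X_zero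
  have e1 : finSuccEquiv R 3 (X 1) = Polynomial.C (X 0) := finSuccEquiv_X_succ (j := 0)
  have e2 : finSuccEquiv R 3 (X 2) = Polynomial.C (X 1) := finSuccEquiv_X_succ (j := 1)
  have e3 : finSuccEquiv R 3 (X 3) = Polynomial.C (X 2) := finSuccEquiv_X_succ (j := 2)
  simp only [quintic, F3, F5, cubicXYZ, quinticXYZ, map_add, map_sub, map_mul, map_pow, map_neg,
    e0, e1, e2, e3, map_ofNat]
  ring

theorem finSuccEquiv_cubicXYZ_monic : (finSuccEquiv R 2 (cubicXYZ R)).Monic := by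
  have e0 : finSuccEquiv R 2 (X 0) = Polynomial.X := finSuccEquiv_X_zero
  have e1 : finSuccEquiv R 2 (X 1) = Polynomial.C (X 0) := finSuccEquiv_X_succ (j := 0)
  have e2 : finSuccEquiv R 2 (X 2) = Polynomial.C (X 1) := finSuccEquiv_X_succ (j := 1)
  have h : finSuccEquiv R 2 (cubicXYZ R) = Polynomial.X ^ 3 +
      (Polynomial.C (3 * (X 0 + X 1) + X 1) * Polynomial.X ^ 2 +
      Polynomial.C (3 * (X 0 + X 1) ^ 2 + X 0 ^ 2 + 2 * X 0 * X 1) * Polynomial.X +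
      Polynomial.C ((X 0 + X 1) ^ 3 + X 0 * X 1 ^ 2)) := by
    simp only [cubicXYZ, map_add, map_mul, map_pow, e0, e1, e2, map_ofNat]
    ring
  rw [h]
  exact Polynomial.monic_X_pow_add Polynomial.degree_quadratic_lt

/-- The specialisation `(X, Y, Z) ↦ (X, 0, 1)`. -/
def specialize : MvPolynomial (Fin 3) R →+* Polynomial R :=
  (Polynomial.mapRingHom (eval ![0, 1])).comp (finSuccEquiv R 2 : MvPolynomial (Fin 3) R →+* _)

variable {R}

theorem specialize_X (i : Fin 3) :
    specialize R (X i) = (![Polynomial.X, 0, 1] : Fin 3 → Polynomial R) i := by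
  have e0 : finSuccEquiv R 2 (X 0) = Polynomial.X := finSuccEquiv_X_zero
  have e1 : finSuccEquiv R 2 (X 1) = Polynomial.C (X 0) := finSuccEquiv_X_succ (j := 0)
  have e2 : finSuccEquiv R 2 (X 2) = Polynomial.C (X 1) := finSuccEquiv_X_succ (j := 1)
  fin_cases i <;> simp [specialize, e0, e1, e2]

theorem specialize_cubicXYZ :
    specialize R (cubicXYZ R) = (Polynomial.X + 1) ^ 3 + Polynomial.X ^ 2 := by
  simp [cubicXYZ, specialize_X]

theorem specialize_quinticXYZ : specialize R (quinticXYZ R) = Polynomial.X ^ 2 := by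
  simp [quinticXYZ, specialize_X]

variable [IsDomain R]

theorem isRelPrime_cubicXYZ_quinticXYZ : IsRelPrime (cubicXYZ R) (quinticXYZ R) := by
  intro r h3 h5
  have hbezout : (1 - 3 * Polynomial.X) * specialize R (cubicXYZ R) +
      (5 + 11 * Polynomial.X + 3 * Polynomial.X ^ 2) * specialize R (quinticXYZ R) = 1 := by
    rw [specialize_cubicXYZ, specialize_quinticXYZ]
    ring
  have hunit : IsUnit (specialize R r) := isUnit_of_dvd_one (hbezout ▸ dvd_add
    ((map_dvd _ h3).mul_left _) ((map_dvd _ h5).mul_left _))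
  exact (MulEquiv.isUnit_map (finSuccEquiv R 2)).1
    (isUnit_of_isUnit_map_of_dvd_monic _ (finSuccEquiv_cubicXYZ_monic R)
      (map_dvd _ h3) hunit)

-- The degree in `X` is odd after the specialisation.
theorem not_isSquare_cubicXYZ_mul_quinticXYZ : ¬ IsSquare (cubicXYZ R * quinticXYZ R) := by
  intro h
  obtain ⟨s, hs⟩ := h.map (specialize R)
  have hdeg : (((Polynomial.X + 1) ^ 3 + Polynomial.X ^ 2) * Polynomial.X ^ 2 :
      Polynomial R).natDegree = 5 := by
    compute_degree!
  rw [map_mul, specialize_cubicXYZ, specialize_quinticXYZ] at hs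
  rw [hs, ← pow_two, Polynomial.natDegree_pow] at hdeg
  lia

variable (R) in
theorem quintic_irreducible : Irreducible (quintic R) := by
  rw [← MulEquiv.irreducible_iff (finSuccEquiv R 3), finSuccEquiv_quintic]
  refine irreducible_quadratic_of_not_isSquare isRelPrime_cubicXYZ_quinticXYZ.neg_right ?_
  rw [mul_neg, neg_neg]
  exact not_isSquare_cubicXYZ_mul_quinticXYZ

end Irreducibility

section ProjectiveSpace

open MvPolynomial

variable {K : Type*} [Field K]

theorem eval_smul_of_isHomogeneous {σ R : Type*} [CommSemiring R] {d : ℕ} {q : MvPolynomial σ R}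
    (hq : q.IsHomogeneous d) (c : R) (v : σ → R) : eval (c • v) q = c ^ d * eval v q := by
  rw [eval_eq, eval_eq, Finset.mul_sum]
  refine Finset.sum_congr rfl fun m hm => ?_
  have hd : ∑ i ∈ m.support, m i = d := by
    rw [← hq (mem_support_iff.1 hm), Finsupp.weight_apply]
    simp [Finsupp.sum]
  simp only [Pi.smul_apply, smul_eq_mul, mul_pow, Finset.prod_mul_distrib,
    Finset.prod_pow_eq_pow_sum, hd]
  ring

theorem mk_mem_projZeros {n d : ℕ} {q : MvPolynomial (Fin n) K} (hq : q.IsHomogeneous d)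
    {v : Fin n → K} (hv : v ≠ 0) : Projectivization.mk K v hv ∈ projZeros q ↔ eval v q = 0 := by
  obtain ⟨c, hc⟩ := Projectivization.exists_smul_eq_mk_rep K v hv
  change eval _ q = 0 ↔ _
  rw [← hc, Units.smul_def, eval_smul_of_isHomogeneous hq]
  simp

theorem mk_mem_image_map_iff {V W : Type*} [AddCommGroup V] [Module K V] [AddCommGroup W]
    [Module K W] {l : V →ₗ[K] W} (hl : Function.Injective l) {S : Set (ℙ K V)} {w : W}
    (hw : w ≠ 0) : Projectivization.mk K w hw ∈ Projectivization.map l hl '' S ↔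
      ∃ (v : V) (hv : v ≠ 0), l v = w ∧ Projectivization.mk K v hv ∈ S := by
  constructor
  · rintro ⟨p, hp, h⟩
    induction p using Projectivization.ind with | h v hv =>
    rw [Projectivization.map_mk, eq_comm, Projectivization.mk_eq_mk_iff] at h
    obtain ⟨a, ha⟩ := h
    refine ⟨a • v, (smul_ne_zero_iff_ne a).2 hv, by rw [Units.smul_def, map_smul]; exact ha, ?_⟩
    rwa [(Projectivization.mk_eq_mk_iff K _ v _ hv).2 ⟨a, rfl⟩]
  · rintro ⟨v, hv, rfl, h⟩
    exact ⟨_, h, Projectivization.map_mk ..⟩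

theorem IsLine.image_map {L : Set (ℙ K (Fin 4 → K))} (hL : IsLine L)
    {g : (Fin 4 → K) →ₗ[K] (Fin 4 → K)} (hg : Function.Injective g) :
    IsLine (Projectivization.map g hg '' L) := by
  obtain ⟨l, hl, rfl⟩ := hL
  exact ⟨g ∘ₗ l, hg.comp hl, by rw [Projectivization.map_comp l hl g hg, Set.range_comp]⟩

theorem IsConic.image_map {C : Set (ℙ K (Fin 4 → K))} (hC : IsConic C)
    {g : (Fin 4 → K) →ₗ[K] (Fin 4 → K)} (hg : Function.Injective g) :
    IsConic (Projectivization.map g hg '' C) := by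
  obtain ⟨l, hl, q, hq, hirr, rfl⟩ := hC
  exact ⟨g ∘ₗ l, hg.comp hl, q, hq, hirr,
    by rw [Projectivization.map_comp l hl g hg, Set.image_comp]⟩

theorem isLine_of_leftInverse {L : Set (ℙ K (Fin 4 → K))} (l : (Fin 2 → K) →ₗ[K] (Fin 4 → K))
    (g : (Fin 4 → K) → (Fin 2 → K)) (hg : Function.LeftInverse g l)
    (h : ∀ (v : Fin 4 → K) (hv : v ≠ 0), Projectivization.mk K v hv ∈ L ↔ l (g v) = v) :
    IsLine L := by
  refine ⟨l, hg.injective, Set.ext fun p => ?_⟩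
  induction p using Projectivization.ind with | h v hv =>
  rw [h v hv, ← Set.image_univ, mk_mem_image_map_iff]
  refine ⟨fun hgv => ⟨g v, ?_, hgv, trivial⟩, fun ⟨x, _, hx, _⟩ => by rw [← hx, hg x]⟩
  intro h0
  exact hv (by rw [← hgv, h0, map_zero])

theorem irreducible_X_mul_X_sub_X_sq (K : Type*) [Field K] :
    Irreducible (X 0 * X 2 - X 1 ^ 2 : MvPolynomial (Fin 3) K) := by
  refine (MulEquiv.irreducible_iff (finSuccEquiv K 2)).1 ?_
  have h0 : finSuccEquiv K 2 (X 0) = Polynomial.X := finSuccEquiv_X_zero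
  have h1 : finSuccEquiv K 2 (X 1) = Polynomial.C (X 0) := finSuccEquiv_X_succ (j := 0)
  have h2 : finSuccEquiv K 2 (X 2) = Polynomial.C (X 1) := finSuccEquiv_X_succ (j := 1)
  have h : finSuccEquiv K 2 (X 0 * X 2 - X 1 ^ 2) =
      Polynomial.C (X 1) * Polynomial.X + Polynomial.C (- X 0 ^ 2) := by
    simp only [map_sub, map_mul, map_pow, map_neg, h0, h1, h2]
    ring
  rw [h]
  refine Polynomial.irreducible_C_mul_X_add_C (X_ne_zero _) ?_
  rw [(X_prime (i := (1 : Fin 2)) (R := K)).irreducible.isRelPrime_iff_not_dvd]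
  rintro ⟨s, hs⟩
  simpa using congrArg (eval ![1, 0]) hs

theorem isConic_of_leftInverse {C : Set (ℙ K (Fin 4 → K))} (l : (Fin 3 → K) →ₗ[K] (Fin 4 → K))
    (g : (Fin 4 → K) → (Fin 3 → K)) (hg : Function.LeftInverse g l)
    (h : ∀ (v : Fin 4 → K) (hv : v ≠ 0),
      Projectivization.mk K v hv ∈ C ↔ l (g v) = v ∧ g v 0 * g v 2 = g v 1 ^ 2) :
    IsConic C := by
  have hX (i : Fin 3) : (X i : MvPolynomial (Fin 3) K).IsHomogeneous 1 := isHomogeneous_X K i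
  have hq : (X 0 * X 2 - X 1 ^ 2 : MvPolynomial (Fin 3) K).IsHomogeneous 2 :=
    ((hX 0).mul (hX 2)).sub ((hX 1).pow 2)
  have hmem {x : Fin 3 → K} (hx : x ≠ 0) : Projectivization.mk K x hx ∈
      projZeros (X 0 * X 2 - X 1 ^ 2) ↔ x 0 * x 2 = x 1 ^ 2 := by
    rw [mk_mem_projZeros hq, map_sub, sub_eq_zero, map_mul, map_pow, eval_X, eval_X, eval_X]
  refine ⟨l, hg.injective, _, hq, irreducible_X_mul_X_sub_X_sq K, Set.ext fun p => ?_⟩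
  induction p using Projectivization.ind with | h v hv =>
  rw [h v hv, mk_mem_image_map_iff]
  constructor
  · rintro ⟨hgv, hv'⟩
    have h0 : g v ≠ 0 := fun h0 => hv (by rw [← hgv, h0, map_zero])
    exact ⟨g v, h0, hgv, (hmem h0).2 hv'⟩
  · rintro ⟨x, hx0, rfl, hx⟩
    rw [hg x]
    exact ⟨rfl, (hmem hx0).1 hx⟩

end ProjectiveSpace

section Curves

/-- The values at `v` of the pairs of equations of the nine lines and the fourteen conics. -/
def curveVal {R : Type*} [CommRing R] (v : Fin 4 → R) : Fin 9 ⊕ Fin 14 → R × R :=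
  Sum.elim
    ![(v 0 - v 3, v 0 + v 2),
      (v 0 - v 2, v 0 + v 3),
      (v 0 - v 2, v 0 + v 1),
      (v 0 - v 1, v 0 + v 2),
      (v 0 - v 1, v 0 + v 3),
      (v 0 - v 3, v 0 + v 1),
      (v 2 - v 3, v 2 + v 1),
      (v 1 - v 3, v 1 + v 2),
      (v 1 - v 2, v 1 + v 3)]
    ![(v 0 - (v 1 + v 2 + v 3),
        v 1 ^ 2 + v 2 ^ 2 + v 3 ^ 2 + 3 * (v 1 * v 2 + v 1 * v 3 + v 2 * v 3)),
      (v 0 + (v 1 + v 2 + v 3),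
        v 1 ^ 2 + v 2 ^ 2 + v 3 ^ 2 + 3 * (v 1 * v 2 + v 1 * v 3 + v 2 * v 3)),
      (v 0 - v 1, v 1 ^ 2 + v 1 * v 2 + 3 * v 1 * v 3 - v 2 * v 3),
      (v 0 + v 1, v 1 ^ 2 + v 1 * v 2 + 3 * v 1 * v 3 - v 2 * v 3),
      (v 0 - v 2, v 2 ^ 2 + v 2 * v 3 + 3 * v 2 * v 1 - v 3 * v 1),
      (v 0 + v 2, v 2 ^ 2 + v 2 * v 3 + 3 * v 2 * v 1 - v 3 * v 1),
      (v 0 - v 3, v 3 ^ 2 + v 3 * v 1 + 3 * v 3 * v 2 - v 1 * v 2),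
      (v 0 + v 3, v 3 ^ 2 + v 3 * v 1 + 3 * v 3 * v 2 - v 1 * v 2),
      (v 3 - v 1, v 0 * (v 2 + 3 * v 1) + v 1 * (v 1 - v 2)),
      (v 3 - v 1, v 0 * (v 2 + 3 * v 1) - v 1 * (v 1 - v 2)),
      (v 2 - v 3, v 0 * (v 1 + 3 * v 3) + v 3 * (v 3 - v 1)),
      (v 2 - v 3, v 0 * (v 1 + 3 * v 3) - v 3 * (v 3 - v 1)),
      (v 1 - v 2, v 0 * (v 3 + 3 * v 2) + v 2 * (v 2 - v 3)),
      (v 1 - v 2, v 0 * (v 3 + 3 * v 2) - v 2 * (v 2 - v 3))]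

/-- For each of the `23` curves, an integral point lying on no other curve. -/
def curvePoint : Fin 9 ⊕ Fin 14 → Fin 4 → ℤ :=
  Sum.elim
    ![![-2, -1, 2, -2], ![-2, -1, -2, 2], ![-2, 2, -2, -1], ![-2, -2, 2, -1], ![-2, -2, -1, 2],
      ![-2, 2, -1, -2], ![0, -1, 1, 1], ![0, -1, 1, -1], ![0, -1, -1, 1]]
    ![![7, 1, 11, -5], ![-7, 1, 11, -5], ![-3, -3, 0, 1], ![-3, 3, 0, -1], ![-3, 1, -3, 0],
      ![-3, -1, 3, 0], ![-3, 0, 1, -3], ![-3, 0, -1, 3], ![-3, 1, -2, 1], ![-3, -1, 2, -1],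
      ![-3, -2, 1, 1], ![-3, 2, -1, -1], ![-3, 1, 1, -2], ![-3, -1, -1, 2]]

/-- The permutation of the `23` curves induced by `tau`. -/
def curveRotate : Fin 9 ⊕ Fin 14 → Fin 9 ⊕ Fin 14 :=
  Sum.map ![3, 2, 5, 4, 1, 0, 8, 6, 7] ![1, 0, 7, 6, 3, 2, 5, 4, 11, 10, 13, 12, 9, 8]

theorem curveVal_map {R S : Type*} [CommRing R] [CommRing S] (f : R →+* S) (v : Fin 4 → R)
    (i : Fin 9 ⊕ Fin 14) : curveVal (f ∘ v) i = Prod.map f f (curveVal v i) := by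
  have h3 : f 3 = 3 := map_ofNat f 3
  rcases i with i | i <;> fin_cases i <;> simp [curveVal, h3]

theorem curveVal_curvePoint_eq_zero_iff :
    ∀ i j, curveVal (curvePoint i) j = 0 ↔ i = j := by
  decide

theorem curveRotate_induction {P : Fin 9 ⊕ Fin 14 → Prop} (hP : ∀ i, P i → P (curveRotate i))
    (hl₀ : P (.inl 0)) (hl₆ : P (.inl 6)) (hc₀ : P (.inr 0)) (hc₂ : P (.inr 2))
    (hc₈ : P (.inr 8)) (i : Fin 9 ⊕ Fin 14) : P i := by
  have hiter {j} (hj : P j) : ∀ n, P (curveRotate^[n] j) := fun n => by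
    induction n with
    | zero => exact hj
    | succ n ih => exact Function.iterate_succ_apply' curveRotate n j ▸ hP _ ih
  have horbit : ∀ i, ∃ j ∈ [.inl 0, .inl 6, .inr 0, .inr 2, .inr 8],
      ∃ n < 6, curveRotate^[n] j = i := by
    decide
  obtain ⟨j, hj, n, -, rfl⟩ := horbit i
  simp only [List.mem_cons, List.not_mem_nil, or_false] at hj
  rcases hj with rfl | rfl | rfl | rfl | rfl
  exacts [hiter hl₀ n, hiter hl₆ n, hiter hc₀ n, hiter hc₂ n, hiter hc₈ n]

variable {K : Type*} [Field K]

variable (K) in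
/-- The nine lines and the fourteen conics. -/
def curve : Fin 9 ⊕ Fin 14 → Set (ℙ K (Fin 4 → K)) := Sum.elim (lineCurve K) (conicCurve K)

theorem mem_curve {p : ℙ K (Fin 4 → K)} {i : Fin 9 ⊕ Fin 14} :
    p ∈ curve K i ↔ curveVal p.rep i = 0 := by
  rcases i with i | i <;> fin_cases i <;>
    simp [curve, lineCurve, conicCurve, projZeros, curveVal, lineEq, conicEq]

theorem curveVal_smul_eq_zero_iff {c : K} (hc : c ≠ 0) (v : Fin 4 → K) (i : Fin 9 ⊕ Fin 14) :
    curveVal (c • v) i = 0 ↔ curveVal v i = 0 := by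
  rcases i with i | i <;> fin_cases i <;>
    refine (Prod.mk_eq_zero.trans ?_).trans Prod.mk_eq_zero.symm <;>
    simp only [Pi.smul_apply, smul_eq_mul] <;> grind

theorem mk_mem_curve {v : Fin 4 → K} (hv : v ≠ 0) {i : Fin 9 ⊕ Fin 14} :
    Projectivization.mk K v hv ∈ curve K i ↔ curveVal v i = 0 := by
  obtain ⟨c, hc⟩ := Projectivization.exists_smul_eq_mk_rep K v hv
  rw [mem_curve, ← hc, Units.smul_def, curveVal_smul_eq_zero_iff c.ne_zero]

theorem curve_injective [CharZero K] : Function.Injective (curve K) := by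
  have hpoint (i) : Int.castRingHom K ∘ curvePoint i ≠ 0 := by
    have hi : curvePoint i ≠ 0 := by revert i; decide
    contrapose! hi
    exact funext fun j => by simpa using congrFun hi j
  have hmem (i j) : Projectivization.mk K _ (hpoint i) ∈ curve K j ↔ i = j := by
    rw [mk_mem_curve, curveVal_map, ← curveVal_curvePoint_eq_zero_iff]
    simp [Prod.ext_iff]
  exact fun i j h => (hmem i j).1 (h ▸ (hmem i i).2 rfl)

theorem curveVal_tauLin_curveRotate (v : Fin 4 → K) (i : Fin 9 ⊕ Fin 14) :
    curveVal (tauLin v) (curveRotate i) = 0 ↔ curveVal v i = 0 := by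
  have h0 : tauLin v 0 = -v 0 := rfl
  have h1 : tauLin v 1 = v 2 := rfl
  have h2 : tauLin v 2 = v 3 := rfl
  have h3 : tauLin v 3 = v 1 := rfl
  rcases i with i | i <;> fin_cases i <;>
    refine (Prod.mk_eq_zero.trans ?_).trans Prod.mk_eq_zero.symm <;> grind

theorem tauLin_surjective : Function.Surjective (tauLin (K := K)) := fun v =>
  ⟨![-v 0, v 3, v 1, v 2], by ext i; fin_cases i <;> simp [tauLin]⟩

theorem tau_surjective : Function.Surjective (tau (K := K)) := by
  intro p
  induction p using Projectivization.ind with | h v hv =>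
  obtain ⟨w, rfl⟩ := tauLin_surjective v
  have hw : w ≠ 0 := by
    rintro rfl
    exact hv (map_zero _)
  exact ⟨Projectivization.mk K w hw, Projectivization.map_mk ..⟩

theorem tau_mem_curve_curveRotate {p : ℙ K (Fin 4 → K)} {i : Fin 9 ⊕ Fin 14} :
    tau p ∈ curve K (curveRotate i) ↔ p ∈ curve K i := by
  induction p using Projectivization.ind with | h v hv =>
  rw [tau, Projectivization.map_mk, mk_mem_curve, mk_mem_curve, curveVal_tauLin_curveRotate]

theorem curve_curveRotate (i : Fin 9 ⊕ Fin 14) : curve K (curveRotate i) = tau '' curve K i := by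
  rw [← Set.image_preimage_eq (curve K (curveRotate i)) tau_surjective]
  exact congrArg _ (Set.ext fun _ => tau_mem_curve_curveRotate)

end Curves

section Parametrizations

open Matrix

theorem vec4_eq_iff {α : Type*} {a b c d : α} {v : Fin 4 → α} :
    ![a, b, c, d] = v ↔ a = v 0 ∧ b = v 1 ∧ c = v 2 ∧ d = v 3 := by
  simp [funext_iff, Fin.forall_fin_succ]

variable {K : Type*} [Field K]

theorem isLine_curve_inl_zero : IsLine (curve K (.inl 0)) := by
  obtain ⟨l, hl⟩ : ∃ l : (Fin 2 → K) →ₗ[K] (Fin 4 → K),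
      ∀ x, l x = ![x 0, x 1, -x 0, x 0] :=
    ⟨!![1, 0; 0, 1; -1, 0; 1, 0].mulVecLin, fun x => by
      ext i
      fin_cases i <;> simp [vecHead, vecTail]⟩
  refine isLine_of_leftInverse l
    (fun v => ![v 0, v 1]) (fun x => ?_) fun v hv => ?_
  · ext i
    fin_cases i <;> simp [hl]
  · rw [mk_mem_curve, hl, vec4_eq_iff]
    refine Prod.mk_eq_zero.trans ?_
    simp only [cons_val]
    grind

theorem isLine_curve_inl_six : IsLine (curve K (.inl 6)) := by
  obtain ⟨l, hl⟩ : ∃ l : (Fin 2 → K) →ₗ[K] (Fin 4 → K),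
      ∀ x, l x = ![x 1, -x 0, x 0, x 0] :=
    ⟨!![0, 1; -1, 0; 1, 0; 1, 0].mulVecLin, fun x => by
      ext i
      fin_cases i <;> simp [vecHead, vecTail]⟩
  refine isLine_of_leftInverse l
    (fun v => ![v 2, v 0]) (fun x => ?_) fun v hv => ?_
  · ext i
    fin_cases i <;> simp [hl]
  · rw [mk_mem_curve, hl, vec4_eq_iff]
    refine Prod.mk_eq_zero.trans ?_
    simp only [cons_val]
    grind

variable [NeZero (2 : K)]

theorem isConic_curve_inr_zero : IsConic (curve K (.inr 0)) := by
  have h2 : (2 : K) ≠ 0 := two_ne_zero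
  obtain ⟨l, hl⟩ : ∃ l : (Fin 3 → K) →ₗ[K] (Fin 4 → K),
      ∀ x, l x = ![x 0 - x 1 + x 2, x 0 - 3 * x 1 + x 2, -x 0 + x 1 + x 2, x 0 + x 1 - x 2] :=
    ⟨!![1, -1, 1; 1, -3, 1; -1, 1, 1; 1, 1, -1].mulVecLin, fun x => by
      ext i
      fin_cases i <;> simp [vecHead, vecTail] <;> ring⟩
  refine isConic_of_leftInverse l
    (fun v => ![(v 1 + v 2 + 2 * v 3) / 2, (v 2 + v 3) / 2, (v 1 + 2 * v 2 + v 3) / 2])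
    (fun x => ?_) fun v hv => ?_
  · ext i
    fin_cases i <;> simp [hl] <;> grind
  · rw [mk_mem_curve, hl, vec4_eq_iff]
    refine Prod.mk_eq_zero.trans ?_
    simp only [cons_val]
    grind

theorem isConic_curve_inr_two : IsConic (curve K (.inr 2)) := by
  have h2 : (2 : K) ≠ 0 := two_ne_zero
  obtain ⟨l, hl⟩ : ∃ l : (Fin 3 → K) →ₗ[K] (Fin 4 → K),
      ∀ x, l x = ![x 1, x 1, -2 * x 0 + 3 * x 1, x 1 - 2 * x 2] :=
    ⟨!![0, 1, 0; 0, 1, 0; -2, 3, 0; 0, 1, -2].mulVecLin, fun x => by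
      ext i
      fin_cases i <;> simp [vecHead, vecTail]
      ring⟩
  refine isConic_of_leftInverse l
    (fun v => ![(3 * v 1 - v 2) / 2, v 1, (v 1 - v 3) / 2])
    (fun x => ?_) fun v hv => ?_
  · ext i
    fin_cases i <;> simp [hl] <;> grind
  · rw [mk_mem_curve, hl, vec4_eq_iff]
    refine Prod.mk_eq_zero.trans ?_
    simp only [cons_val]
    grind

theorem isConic_curve_inr_eight : IsConic (curve K (.inr 8)) := by
  have h2 : (2 : K) ≠ 0 := two_ne_zero
  obtain ⟨l, hl⟩ : ∃ l : (Fin 3 → K) →ₗ[K] (Fin 4 → K),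
      ∀ x, l x = ![x 1 - 2 * x 2, x 1, 2 * x 0 - 3 * x 1, x 1] :=
    ⟨!![0, 1, -2; 0, 1, 0; 2, -3, 0; 0, 1, 0].mulVecLin, fun x => by
      ext i
      fin_cases i <;> simp [vecHead, vecTail] <;> ring⟩
  refine isConic_of_leftInverse l
    (fun v => ![(3 * v 1 + v 2) / 2, v 1, (v 1 - v 0) / 2])
    (fun x => ?_) fun v hv => ?_
  · ext i
    fin_cases i <;> simp [hl] <;> grind
  · rw [mk_mem_curve, hl, vec4_eq_iff]
    refine Prod.mk_eq_zero.trans ?_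
    simp only [cons_val]
    grind

theorem isLine_or_isConic_curve (i : Fin 9 ⊕ Fin 14) :
    Sum.elim (fun j => IsLine (lineCurve K j)) (fun j => IsConic (conicCurve K j)) i := by
  refine curveRotate_induction (fun i hi => ?_) isLine_curve_inl_zero isLine_curve_inl_six
    isConic_curve_inr_zero isConic_curve_inr_two isConic_curve_inr_eight i
  rcases i with j | j
  · change IsLine (curve K (curveRotate (.inl j)))
    exact curve_curveRotate (K := K) (.inl j) ▸ IsLine.image_map hi tauLin_injective
  · change IsConic (curve K (curveRotate (.inr j)))
    exact curve_curveRotate (K := K) (.inr j) ▸ IsConic.image_map hi tauLin_injective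

theorem isLine_lineCurve (i : Fin 9) : IsLine (lineCurve K i) := isLine_or_isConic_curve (.inl i)

theorem isConic_conicCurve (i : Fin 14) : IsConic (conicCurve K i) :=
  isLine_or_isConic_curve (.inr i)

end Parametrizations

section Complement

open MvPolynomial

theorem boundaryPoly_isHomogeneous (R : Type*) [CommRing R] :
    (boundaryPoly R).IsHomogeneous 14 := by
  have hX (i : Fin 4) : (X i : MvPolynomial (Fin 4) R).IsHomogeneous 1 := isHomogeneous_X R i
  have hsub (i j : Fin 4) : (X i ^ 2 - X j ^ 2 : MvPolynomial (Fin 4) R).IsHomogeneous 2 :=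
    ((hX i).pow 2).sub ((hX j).pow 2)
  have hquad : (X 0 ^ 2 + X 1 * X 2 + X 2 * X 3 + X 1 * X 3 :
      MvPolynomial (Fin 4) R).IsHomogeneous 2 :=
    ((((hX 0).pow 2).add ((hX 1).mul (hX 2))).add ((hX 2).mul (hX 3))).add ((hX 1).mul (hX 3))
  exact (((((hquad.mul (hsub 0 1)).mul (hsub 0 2)).mul (hsub 0 3)).mul (hsub 1 2)).mul
    (hsub 2 3)).mul (hsub 1 3)

theorem boundaryPoly_ne_zero (R : Type*) [CommRing R] [CharZero R] : boundaryPoly R ≠ 0 := by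
  have h : eval ![0, 1, 2, 3] (boundaryPoly R) = (47520 : ℕ) := by
    simp only [boundaryPoly, map_mul, map_add, map_sub, map_pow, eval_X, Matrix.cons_val]
    norm_num
  intro h0
  rw [h0, map_zero] at h
  exact absurd h (by norm_cast)

/-- The value of `W²F₃ - F₅` at `v = (W, X, Y, Z)`. -/
def quinticVal {R : Type*} [CommRing R] (v : Fin 4 → R) : R :=
  v 0 ^ 2 * ((v 1 + v 2 + v 3) ^ 3 + (v 1 ^ 2 * v 3 + v 1 * v 2 ^ 2 + v 2 * v 3 ^ 2) +
    2 * v 1 * v 2 * v 3) - ((v 3 ^ 3 * v 1 ^ 2 + v 1 ^ 3 * v 2 ^ 2 + v 2 ^ 3 * v 3 ^ 2) -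
    v 1 * v 2 * v 3 * (v 2 * v 3 + v 1 * v 2 + v 1 * v 3))

theorem eval_quintic {R : Type*} [CommRing R] (v : Fin 4 → R) :
    eval v (quintic R) = quinticVal v := by
  simp [quintic, F3, F5, quinticVal]

variable {K : Type*} [Field K]

theorem mk_mem_S6 {v : Fin 4 → K} (hv : v ≠ 0) :
    Projectivization.mk K v hv ∈ S6 K ↔ quinticVal v = 0 := by
  rw [← eval_quintic]
  exact mk_mem_projZeros (quintic_isHomogeneous K) hv

/-- The condition `W² + XY + YZ + XZ ≠ 0` with `W², X², Y², Z²` pairwise distinct, which cuts out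
the open subset `U`. -/
def IsGeneric (v : Fin 4 → K) : Prop :=
  quadForm v ≠ 0 ∧ Function.Injective fun i => v i ^ 2

theorem not_isGeneric_iff {v : Fin 4 → K} :
    ¬ IsGeneric v ↔ quadForm v = 0 ∨ v 0 ^ 2 = v 1 ^ 2 ∨ v 0 ^ 2 = v 2 ^ 2 ∨ v 0 ^ 2 = v 3 ^ 2 ∨
      v 1 ^ 2 = v 2 ^ 2 ∨ v 2 ^ 2 = v 3 ^ 2 ∨ v 1 ^ 2 = v 3 ^ 2 := by
  have hinj : Function.Injective (fun i => v i ^ 2) ↔ v 0 ^ 2 ≠ v 1 ^ 2 ∧ v 0 ^ 2 ≠ v 2 ^ 2 ∧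
      v 0 ^ 2 ≠ v 3 ^ 2 ∧ v 1 ^ 2 ≠ v 2 ^ 2 ∧ v 2 ^ 2 ≠ v 3 ^ 2 ∧ v 1 ^ 2 ≠ v 3 ^ 2 := by
    refine ⟨fun h => by refine ⟨?_, ?_, ?_, ?_, ?_, ?_⟩ <;> exact h.ne (by decide), ?_⟩
    rintro ⟨h01, h02, h03, h12, h23, h13⟩ i j h
    fin_cases i <;> fin_cases j <;> simp_all
  rw [IsGeneric, hinj]
  tauto

theorem eval_boundaryPoly (v : Fin 4 → K) :
    eval v (boundaryPoly K) = quadForm v * (v 0 ^ 2 - v 1 ^ 2) * (v 0 ^ 2 - v 2 ^ 2) *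
      (v 0 ^ 2 - v 3 ^ 2) * (v 1 ^ 2 - v 2 ^ 2) * (v 2 ^ 2 - v 3 ^ 2) * (v 1 ^ 2 - v 3 ^ 2) := by
  simp [boundaryPoly, quadForm]

theorem eval_boundaryPoly_eq_zero_iff {v : Fin 4 → K} :
    eval v (boundaryPoly K) = 0 ↔ ¬ IsGeneric v := by
  simp only [eval_boundaryPoly, not_isGeneric_iff, mul_eq_zero, sub_eq_zero, or_assoc]

theorem quinticVal_tauLin (v : Fin 4 → K) : quinticVal (tauLin v) = quinticVal v := by
  simp only [quinticVal, tauLin, LinearMap.coe_mk, AddHom.coe_mk, Matrix.cons_val]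
  ring

theorem isGeneric_tauLin {v : Fin 4 → K} : IsGeneric (tauLin v) ↔ IsGeneric v := by
  rw [← not_iff_not, not_isGeneric_iff, not_isGeneric_iff]
  simp only [quadForm, tauLin, LinearMap.coe_mk, AddHom.coe_mk, Matrix.cons_val, neg_sq]
  grind

theorem quinticVal_eq_zero_and_not_isGeneric_of_curveVal {i : Fin 9 ⊕ Fin 14} {v : Fin 4 → K}
    (hv : curveVal v i = 0) : quinticVal v = 0 ∧ ¬ IsGeneric v := by
  revert v
  refine curveRotate_induction
    (P := fun i => ∀ {v : Fin 4 → K}, curveVal v i = 0 → quinticVal v = 0 ∧ ¬ IsGeneric v)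
    (fun i hi v hv => ?_) ?_ ?_ ?_ ?_ ?_ i
  · obtain ⟨w, rfl⟩ := tauLin_surjective v
    rw [quinticVal_tauLin, isGeneric_tauLin]
    exact hi ((curveVal_tauLin_curveRotate w i).1 hv)
  all_goals
    intro v hv
    rw [not_isGeneric_iff, quinticVal, quadForm]
    obtain ⟨h1, h2⟩ := Prod.mk_eq_zero.1 hv
    grind

theorem exists_curveVal_eq_zero_tauLin {v : Fin 4 → K} :
    (∃ i, curveVal (tauLin v) i = 0) ↔ ∃ i, curveVal v i = 0 := by
  have hsurj : Function.Surjective curveRotate := by decide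
  exact hsurj.exists.trans (exists_congr (curveVal_tauLin_curveRotate v))

theorem exists_curveVal_eq_zero {v : Fin 4 → K} (i : Fin 9 ⊕ Fin 14) {a b : K}
    (hi : curveVal v i = (a, b)) (ha : a = 0) (hb : b = 0) : ∃ i, curveVal v i = 0 :=
  ⟨i, by rw [hi, ha, hb]; rfl⟩

theorem exists_curveVal_eq_zero_of_quadForm {v : Fin 4 → K} (h : quinticVal v = 0)
    (hQ : quadForm v = 0) : ∃ i, curveVal v i = 0 := by
  unfold quinticVal at h
  unfold quadForm at hQ
  have hprod : ((v 1 + v 2 + v 3) ^ 2 + (v 1 * v 2 + v 2 * v 3 + v 1 * v 3)) *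
      (v 1 + v 2) * (v 2 + v 3) * (v 3 + v 1) = 0 := by
    linear_combination -h + hQ * ((v 1 + v 2 + v 3) ^ 3 + (v 1 ^ 2 * v 3 + v 1 * v 2 ^ 2 +
      v 2 * v 3 ^ 2) + 2 * v 1 * v 2 * v 3)
  simp only [mul_eq_zero] at hprod
  rcases hprod with ((h1 | h1) | h1) | h1
  · have hsq : v 0 ^ 2 = (v 1 + v 2 + v 3) ^ 2 := by linear_combination hQ - h1
    rcases sq_eq_sq_iff_eq_or_eq_neg.1 hsq with h0 | h0
    · exact exists_curveVal_eq_zero (.inr 0) rfl (by grind) (by grind)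
    · exact exists_curveVal_eq_zero (.inr 1) rfl (by grind) (by grind)
  · have hsq : v 0 ^ 2 = v 1 ^ 2 := by linear_combination hQ - (v 3 + v 1) * h1
    rcases sq_eq_sq_iff_eq_or_eq_neg.1 hsq with h0 | h0
    · exact exists_curveVal_eq_zero (.inl 3) rfl (by grind) (by grind)
    · exact exists_curveVal_eq_zero (.inl 2) rfl (by grind) (by grind)
  · have hsq : v 0 ^ 2 = v 2 ^ 2 := by linear_combination hQ - (v 1 + v 2) * h1
    rcases sq_eq_sq_iff_eq_or_eq_neg.1 hsq with h0 | h0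
    · exact exists_curveVal_eq_zero (.inl 1) rfl (by grind) (by grind)
    · exact exists_curveVal_eq_zero (.inl 0) rfl (by grind) (by grind)
  · have hsq : v 0 ^ 2 = v 1 ^ 2 := by linear_combination hQ - (v 1 + v 2) * h1
    rcases sq_eq_sq_iff_eq_or_eq_neg.1 hsq with h0 | h0
    · exact exists_curveVal_eq_zero (.inl 4) rfl (by grind) (by grind)
    · exact exists_curveVal_eq_zero (.inl 5) rfl (by grind) (by grind)

theorem exists_curveVal_eq_zero_of_sq_zero_eq_sq_one {v : Fin 4 → K} (h : quinticVal v = 0)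
    (hsq : v 0 ^ 2 = v 1 ^ 2) : ∃ i, curveVal v i = 0 := by
  have hprod : (v 1 ^ 2 + v 1 * v 2 + 3 * v 1 * v 3 - v 2 * v 3) * (v 1 + v 2) ^ 2 *
      (v 1 + v 3) = 0 := by
    rw [quinticVal, hsq] at h
    linear_combination h
  simp only [mul_eq_zero, pow_eq_zero_iff two_ne_zero] at hprod
  rcases sq_eq_sq_iff_eq_or_eq_neg.1 hsq with h0 | h0 <;> rcases hprod with (h1 | h1) | h1
  · exact exists_curveVal_eq_zero (.inr 2) rfl (by grind) h1
  · exact exists_curveVal_eq_zero (.inl 3) rfl (by grind) (by grind)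
  · exact exists_curveVal_eq_zero (.inl 4) rfl (by grind) (by grind)
  · exact exists_curveVal_eq_zero (.inr 3) rfl (by grind) h1
  · exact exists_curveVal_eq_zero (.inl 2) rfl (by grind) (by grind)
  · exact exists_curveVal_eq_zero (.inl 5) rfl (by grind) (by grind)

theorem exists_curveVal_eq_zero_of_sq_one_eq_sq_two {v : Fin 4 → K} (h : quinticVal v = 0)
    (hsq : v 1 ^ 2 = v 2 ^ 2) : ∃ i, curveVal v i = 0 := by
  rcases sq_eq_sq_iff_eq_or_eq_neg.1 hsq with h0 | h0 <;> rw [quinticVal, h0] at h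
  · have hprod : (v 0 * (v 3 + 3 * v 2) + v 2 * (v 2 - v 3)) *
        (v 0 * (v 3 + 3 * v 2) - v 2 * (v 2 - v 3)) * (v 2 + v 3) = 0 := by
      linear_combination h
    simp only [mul_eq_zero] at hprod
    rcases hprod with (h1 | h1) | h1
    · exact exists_curveVal_eq_zero (.inr 12) rfl (by grind) h1
    · exact exists_curveVal_eq_zero (.inr 13) rfl (by grind) h1
    · exact exists_curveVal_eq_zero (.inl 8) rfl (by grind) (by grind)
  · have hprod : (v 0 - v 2) * (v 0 + v 2) * (v 3 + v 2) ^ 2 * (v 3 - v 2) = 0 := by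
      linear_combination h
    simp only [mul_eq_zero, pow_eq_zero_iff two_ne_zero] at hprod
    rcases hprod with ((h1 | h1) | h1) | h1
    · exact exists_curveVal_eq_zero (.inl 2) rfl h1 (by grind)
    · exact exists_curveVal_eq_zero (.inl 3) rfl (by grind) h1
    · exact exists_curveVal_eq_zero (.inl 7) rfl (by grind) (by grind)
    · exact exists_curveVal_eq_zero (.inl 6) rfl (by grind) (by grind)

theorem exists_curveVal_eq_zero_iff {v : Fin 4 → K} :
    (∃ i, curveVal v i = 0) ↔ quinticVal v = 0 ∧ ¬ IsGeneric v := by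
  refine ⟨fun ⟨_, hi⟩ => quinticVal_eq_zero_and_not_isGeneric_of_curveVal hi, fun ⟨h, hv⟩ => ?_⟩
  have h₁ : quinticVal (tauLin v) = 0 := by rwa [quinticVal_tauLin]
  have h₂ : quinticVal (tauLin (tauLin v)) = 0 := by rwa [quinticVal_tauLin]
  have hneg : (-v 0) ^ 2 = v 0 ^ 2 := neg_sq _
  rcases not_isGeneric_iff.1 hv with hv | hv | hv | hv | hv | hv | hv
  · exact exists_curveVal_eq_zero_of_quadForm h hv
  · exact exists_curveVal_eq_zero_of_sq_zero_eq_sq_one h hv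
  · exact exists_curveVal_eq_zero_tauLin.1
      (exists_curveVal_eq_zero_of_sq_zero_eq_sq_one h₁ (hneg.trans hv))
  · exact exists_curveVal_eq_zero_tauLin.1 (exists_curveVal_eq_zero_tauLin.1
      (exists_curveVal_eq_zero_of_sq_zero_eq_sq_one h₂ ((congrArg (· ^ 2) (neg_neg _)).trans hv)))
  · exact exists_curveVal_eq_zero_of_sq_one_eq_sq_two h hv
  · exact exists_curveVal_eq_zero_tauLin.1 (exists_curveVal_eq_zero_of_sq_one_eq_sq_two h₁ hv)
  · exact exists_curveVal_eq_zero_tauLin.1 (exists_curveVal_eq_zero_tauLin.1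
      (exists_curveVal_eq_zero_of_sq_one_eq_sq_two h₂ hv.symm))

theorem S6_inter_boundaryPoly : S6 K ∩ projZeros (boundaryPoly K) = ⋃ i, curve K i := by
  ext p
  induction p using Projectivization.ind with | h v hv =>
  simp only [Set.mem_inter_iff, Set.mem_iUnion, mk_mem_S6,
    mk_mem_projZeros (boundaryPoly_isHomogeneous K), mk_mem_curve, exists_curveVal_eq_zero_iff,
    eval_boundaryPoly_eq_zero_iff]

theorem iUnion_curve : ⋃ i, curve K i = (⋃ i, lineCurve K i) ∪ ⋃ i, conicCurve K i :=
  Set.iUnion_sum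

end Complement

section Birational

variable {K : Type*} [Field K]

theorem phi_apply_zero (t : Fin 3 → K) : phi t 0 = -t 1 + t 2 - t 1 * t 2 + t 0 * t 1 := rfl

theorem phi_apply_one (t : Fin 3 → K) :
    phi t 1 = -t 1 - t 2 + t 1 * t 2 + 2 * t 0 - t 0 * t 1 := rfl

theorem phi_apply_two (t : Fin 3 → K) : phi t 2 = t 1 - t 2 - t 1 * t 2 + t 0 * t 1 := rfl

theorem phi_apply_three (t : Fin 3 → K) : phi t 3 = t 1 + t 2 - t 0 * t 1 - t 1 * t 2 := rfl

theorem quadForm_phi (t : Fin 3 → K) :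
    quadForm (phi t) = 2 ^ 2 * (t 1 * (1 - t 1) * (t 0 - t 2)) := by
  simp only [quadForm, phi_apply_zero, phi_apply_one, phi_apply_two, phi_apply_three]
  ring

theorem quadForm_smul (c : K) (v : Fin 4 → K) : quadForm (c • v) = c ^ 2 * quadForm v := by
  simp only [quadForm, Pi.smul_apply, smul_eq_mul]
  ring

/-- The affine cone over `projDomain`, on which `psi` is defined without junk values. -/
def coneDomain (K : Type*) [Field K] : Set (Fin 4 → K) :=
  {v | quadForm v * (v 1 + v 2) * (v 0 + v 2) * (v 0 - v 1) ≠ 0}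

theorem smul_mem_coneDomain {c : K} (hc : c ≠ 0) {v : Fin 4 → K} :
    c • v ∈ coneDomain K ↔ v ∈ coneDomain K := by
  have : quadForm (c • v) * ((c • v) 1 + (c • v) 2) * ((c • v) 0 + (c • v) 2) *
      ((c • v) 0 - (c • v) 1) =
      c ^ 5 * (quadForm v * (v 1 + v 2) * (v 0 + v 2) * (v 0 - v 1)) := by
    rw [quadForm_smul]
    simp only [Pi.smul_apply, smul_eq_mul]
    ring
  change _ ≠ 0 ↔ _ ≠ 0
  rw [this]
  simp [hc]

theorem mk_mem_projDomain {v : Fin 4 → K} (hv : v ≠ 0) :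
    Projectivization.mk K v hv ∈ projDomain K ↔ v ∈ coneDomain K := by
  obtain ⟨c, hc⟩ := Projectivization.exists_smul_eq_mk_rep K v hv
  change Projectivization.rep _ ∈ coneDomain K ↔ _
  rw [← hc, Units.smul_def, smul_mem_coneDomain c.ne_zero]

theorem coneDomain_ne_zero {v : Fin 4 → K} (hv : v ∈ coneDomain K) : v ≠ 0 := by
  rintro rfl
  simp [coneDomain] at hv

theorem psi_smul {c : K} (hc : c ≠ 0) (v : Fin 4 → K) : psi (c • v) = psi v := by
  simp only [psi, quadForm_smul, Pi.smul_apply, smul_eq_mul]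
  have h1 : (c * v 1 + c * v 3) * (c * v 0 + c * v 2) / (c ^ 2 * quadForm v) =
      (v 1 + v 3) * (v 0 + v 2) / quadForm v := by
    rw [← mul_div_mul_left _ (quadForm v) (pow_ne_zero 2 hc)]
    ring
  have h2 : (c * v 0 + c * v 2) / (c * v 1 + c * v 2) = (v 0 + v 2) / (v 1 + v 2) := by
    rw [← mul_add, ← mul_add, mul_div_mul_left _ _ hc]
  have h3 : (c * v 0 + c * v 3) * (c * v 0 + c * v 2) / (c ^ 2 * quadForm v) =
      (v 0 + v 3) * (v 0 + v 2) / quadForm v := by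
    rw [← mul_div_mul_left _ (quadForm v) (pow_ne_zero 2 hc)]
    ring
  rw [h1, h2, h3]

theorem psi_rep_mk {v : Fin 4 → K} (hv : v ≠ 0) :
    psi (Projectivization.mk K v hv).rep = psi v := by
  obtain ⟨c, hc⟩ := Projectivization.exists_smul_eq_mk_rep K v hv
  rw [← hc, Units.smul_def, psi_smul c.ne_zero]

theorem psi_mem_affineDomain {v : Fin 4 → K} (hv : v ∈ coneDomain K) :
    psi v ∈ affineDomain K := by
  simp only [coneDomain, Set.mem_ofPred_eq, ne_eq, mul_eq_zero, not_or] at hv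
  obtain ⟨⟨⟨hQ, h12⟩, h02⟩, h01⟩ := hv
  have e : psi v 1 * (psi v 1 - 1) * (psi v 0 - psi v 2) =
      -((v 0 + v 2) ^ 2 * (v 0 - v 1) ^ 2 / ((v 1 + v 2) ^ 2 * quadForm v)) := by
    simp only [psi, Matrix.cons_val]
    field_simp
    ring
  change _ ≠ 0
  rw [e]
  exact neg_ne_zero.2 (div_ne_zero (mul_ne_zero (pow_ne_zero 2 h02) (pow_ne_zero 2 h01))
    (mul_ne_zero (pow_ne_zero 2 h12) hQ))

theorem phi_psi {v : Fin 4 → K} (hv : v ∈ coneDomain K) :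
    phi (psi v) = (2 * (v 1 - v 0) * (v 0 + v 2) / (quadForm v * (v 1 + v 2))) • v := by
  simp only [coneDomain, Set.mem_ofPred_eq, ne_eq, mul_eq_zero, not_or] at hv
  obtain ⟨⟨⟨hQ, h12⟩, h02⟩, -⟩ := hv
  ext i
  fin_cases i <;> simp only [phi, psi, Pi.smul_apply, smul_eq_mul, Matrix.cons_val, Fin.mk_one,
    Fin.zero_eta, Fin.reduceFinMk] <;> field_simp <;> simp only [quadForm] <;> ring

variable [NeZero (2 : K)]

theorem phi_mem_coneDomain {t : Fin 3 → K} (ht : t ∈ affineDomain K) : phi t ∈ coneDomain K := by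
  simp only [affineDomain, Set.mem_ofPred_eq, ne_eq, mul_eq_zero, not_or] at ht
  obtain ⟨⟨h1, h1'⟩, h02⟩ := ht
  have e : quadForm (phi t) * (phi t 1 + phi t 2) * (phi t 0 + phi t 2) * (phi t 0 - phi t 1) =
      -(2 ^ 5 * (t 1 ^ 2 * (t 1 - 1) ^ 2 * (t 0 - t 2) ^ 4)) := by
    rw [quadForm_phi]
    simp only [phi_apply_zero, phi_apply_one, phi_apply_two]
    ring
  change _ ≠ 0
  rw [e]
  simp [h1, h1', h02, two_ne_zero]

theorem phi_ne_zero {t : Fin 3 → K} (ht : t ∈ affineDomain K) : phi t ≠ 0 :=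
  coneDomain_ne_zero (phi_mem_coneDomain ht)

theorem psi_phi {t : Fin 3 → K} (ht : t ∈ affineDomain K) : psi (phi t) = t := by
  simp only [affineDomain, Set.mem_ofPred_eq, ne_eq, mul_eq_zero, not_or] at ht
  obtain ⟨⟨h1, h1'⟩, h02⟩ := ht
  have h1'' : 1 - t 1 ≠ 0 := fun h => h1' (by linear_combination -h)
  have e13 : phi t 1 + phi t 3 = 2 * (t 0 * (1 - t 1)) := by
    simp only [phi_apply_one, phi_apply_three]; ring
  have e02 : phi t 0 + phi t 2 = 2 * (t 1 * (t 0 - t 2)) := by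
    simp only [phi_apply_zero, phi_apply_two]; ring
  have e12 : phi t 1 + phi t 2 = 2 * (t 0 - t 2) := by
    simp only [phi_apply_one, phi_apply_two]; ring
  have e03 : phi t 0 + phi t 3 = 2 * (t 2 * (1 - t 1)) := by
    simp only [phi_apply_zero, phi_apply_three]; ring
  have h2 : (2 : K) ≠ 0 := two_ne_zero
  ext i
  fin_cases i <;> simp only [psi, quadForm_phi, Matrix.cons_val, Fin.mk_one,
    Fin.zero_eta, Fin.reduceFinMk, e13, e02, e12, e03] <;> field_simp

theorem mk_phi_psi {v : Fin 4 → K} (hv : v ∈ coneDomain K) :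
    Projectivization.mk K (phi (psi v)) (phi_ne_zero (psi_mem_affineDomain hv)) =
      Projectivization.mk K v (coneDomain_ne_zero hv) := by
  rw [Projectivization.mk_eq_mk_iff']
  exact ⟨_, (phi_psi hv).symm⟩

/-- The bijection from `affineDomain` to `projDomain` given by the rational maps `φ` and `ψ`. -/
def phiEquiv (K : Type*) [Field K] [NeZero (2 : K)] : affineDomain K ≃ projDomain K where
  toFun t := ⟨Projectivization.mk K (phi t.1) (phi_ne_zero t.2),
    (mk_mem_projDomain _).2 (phi_mem_coneDomain t.2)⟩
  invFun p := ⟨psi p.1.rep, psi_mem_affineDomain p.2⟩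
  left_inv t := Subtype.ext ((psi_rep_mk _).trans (psi_phi t.2))
  right_inv p := Subtype.ext (by
    have := mk_phi_psi (v := p.1.rep) p.2
    rw [Projectivization.mk_rep] at this
    exact this)

end Birational

section BirationalIso

open MvPolynomial

variable {k : Type*} {K : Type*} [Field k] [Field K] [Algebra k K] {T : Type*} {A : FunSpace K T}

variable (k K) in
theorem FunSpace.isLocallyRinged_projSpace (n : ℕ) : IsLocallyRinged k (projSpace k K n) :=
  ((isLocallyRinged_affineSpace k K (Fin n)).induced _).quotient _

theorem FunSpace.Hom.into_projSpace (hA : IsLocallyRinged k A) {n : ℕ} {f : T → Fin n → K}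
    (h0 : ∀ x, f x ≠ 0) (hf : ∀ i, A.regular Set.univ fun x => f x i) :
    Hom A (projSpace k K n) fun x => Projectivization.mk K (f x) (h0 x) :=
  (hom_quotient _ _).comp
    (Hom.into_induced (f := fun x => (⟨f x, h0 x⟩ : {v : Fin n → K // v ≠ 0})) hA
      (Hom.into_affineSpace hA hf))

theorem regular_phi (hA : A.IsLocallyRinged k) {t : T → Fin 3 → K}
    (ht : ∀ i, A.regular Set.univ fun x => t x i) (i : Fin 4) :
    A.regular Set.univ fun x => phi (t x) i := by
  fin_cases i
  · exact hA.regular_of_eq_aeval ht (-X 1 + X 2 - X 1 * X 2 + X 0 * X 1) fun x => by simp [phi]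
  · exact hA.regular_of_eq_aeval ht (-X 1 - X 2 + X 1 * X 2 + 2 * X 0 - X 0 * X 1)
      fun x => by simp [phi]
  · exact hA.regular_of_eq_aeval ht (X 1 - X 2 - X 1 * X 2 + X 0 * X 1) fun x => by simp [phi]
  · exact hA.regular_of_eq_aeval ht (X 1 + X 2 - X 0 * X 1 - X 1 * X 2) fun x => by simp [phi]

theorem regular_psi (hA : A.IsLocallyRinged k) {v : T → Fin 4 → K}
    (hv : ∀ i, A.regular Set.univ fun x => v x i) (hmem : ∀ x, v x ∈ coneDomain K) (i : Fin 3) :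
    A.regular Set.univ fun x => psi (v x) i := by
  have hne (x : T) : quadForm (v x) ≠ 0 ∧ v x 1 + v x 2 ≠ 0 := by
    have := hmem x
    simp only [coneDomain, Set.mem_ofPred_eq, ne_eq, mul_eq_zero, not_or] at this
    exact ⟨this.1.1.1, this.1.1.2⟩
  have hadd (i j : Fin 4) := hA.add (hv i) (hv j)
  have hQ : A.regular Set.univ fun x => quadForm (v x) :=
    hA.regular_of_eq_aeval hv (X 0 ^ 2 + X 1 * X 2 + X 2 * X 3 + X 1 * X 3) fun x => by
      simp [quadForm]
  fin_cases i
  · exact hA.div (hA.mul (hadd 1 3) (hadd 0 2)) hQ fun x _ => (hne x).1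
  · exact hA.div (hadd 0 2) (hadd 1 2) fun x _ => (hne x).2
  · exact hA.div (hA.mul (hadd 0 3) (hadd 0 2)) hQ fun x _ => (hne x).1

variable (k K) in
theorem isOpen_coneDomain : IsOpen[(affineSpace k K (Fin 4)).top] (coneDomain K) := by
  convert FunSpace.isOpen_aeval_ne_zero (k := k) (K := K)
    (σ := Fin 4) ((X 0 ^ 2 + X 1 * X 2 + X 2 * X 3 + X 1 * X 3) * (X 1 + X 2) * (X 0 + X 2) *
      (X 0 - X 1)) using 1
  simp [coneDomain, quadForm]

variable (k K) in
theorem hom_psi : FunSpace.Hom ((projSpace k K 4).induced (Subtype.val : projDomain K → _))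
    (affineSpace k K (Fin 3)) fun p => psi p.1.rep := by
  have hval := FunSpace.hom_induced (affineSpace k K (Fin 4))
    (Subtype.val : {v : Fin 4 → K // v ≠ 0} → (Fin 4 → K))
  have hA := (FunSpace.isLocallyRinged_affineSpace k K (Fin 4)).induced
    (Subtype.val : {v : Fin 4 → K // v ≠ 0} → (Fin 4 → K))
  have hcone : Projectivization.mk' K ⁻¹' projDomain K =
      (Subtype.val ⁻¹' coneDomain K : Set {v : Fin 4 → K // v ≠ 0}) :=
    Set.ext fun v => mk_mem_projDomain v.2
  refine .of_comp_quotient_restrict hA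
    (hcone ▸ hval.isOpen_preimage _ (isOpen_coneDomain k K)) ?_
  have hpsi : (fun p : projDomain K => psi p.1.rep) ∘
      (projDomain K).restrictPreimage (Projectivization.mk' K) = fun v => psi v.1.1 :=
    funext fun v => psi_rep_mk v.1.2
  rw [hpsi]
  exact .into_affineSpace (hA.induced _) (regular_psi (hA.induced _)
    (hval.comp (FunSpace.hom_induced _ _)).regular_coord fun v => (mk_mem_projDomain v.1.2).1 v.2)

variable (k K) in
theorem phiEquiv_isIso [NeZero (2 : K)] :
    FunSpace.IsIso ((affineSpace k K (Fin 3)).induced Subtype.val)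
      ((projSpace k K 4).induced Subtype.val) (phiEquiv K) := by
  have hA := (FunSpace.isLocallyRinged_affineSpace k K (Fin 3)).induced
    (Subtype.val : affineDomain K → _)
  have hB := (FunSpace.isLocallyRinged_projSpace k K 4).induced (Subtype.val : projDomain K → _)
  exact FunSpace.isIso_of_hom
    (.into_induced hA (.into_projSpace hA (fun t => phi_ne_zero t.2)
      (regular_phi hA (FunSpace.hom_induced _ _).regular_coord)))
    (.into_induced hB (hom_psi k K))

end BirationalIso

section Bracket

variable {R : Type*} [CommRing R]

/-- The determinant of two vectors of the plane, which vanishes iff they represent the same point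
of `ℙ¹`. -/
def bracket (p q : Fin 2 → R) : R := p 0 * q 1 - p 1 * q 0

theorem bracket_self (p : Fin 2 → R) : bracket p p = 0 := by
  rw [bracket, mul_comm, sub_self]

theorem bracket_smul_smul (a b : R) (p q : Fin 2 → R) :
    bracket (a • p) (b • q) = a * b * bracket p q := by
  simp only [bracket, Pi.smul_apply, smul_eq_mul]
  ring

theorem bracket_mulVec (M : Matrix (Fin 2) (Fin 2) R) (p q : Fin 2 → R) :
    bracket (M.mulVec p) (M.mulVec q) = M.det * bracket p q := by
  simp only [bracket, Matrix.mulVec, dotProduct, Fin.sum_univ_two, Matrix.det_fin_two]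
  ring

end Bracket

section HomogeneousCoordinates

variable {K : Type*} [Field K]

theorem mk_eq_mk_iff_bracket {p q : Fin 2 → K} (hp : p ≠ 0) (hq : q ≠ 0) :
    Projectivization.mk K p hp = Projectivization.mk K q hq ↔ bracket p q = 0 := by
  rw [Projectivization.mk_eq_mk_iff', bracket]
  constructor
  · rintro ⟨a, rfl⟩
    simp only [Pi.smul_apply, smul_eq_mul]
    ring
  · intro h
    by_cases h0 : q 0 = 0
    · have h1 : q 1 ≠ 0 := by
        contrapose! hq
        ext i
        fin_cases i <;> simp [h0, hq]
      have hp0 : p 0 = 0 := by simpa [h0, h1] using h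
      refine ⟨p 1 / q 1, ?_⟩
      ext i
      fin_cases i <;> simp [h0, hp0, h1]
    · refine ⟨p 0 / q 0, ?_⟩
      ext i
      fin_cases i
      · simp [h0]
      · simp only [Fin.mk_one, Pi.smul_apply, smul_eq_mul]
        field_simp
        linear_combination h

theorem quadMap_smul_smul (c d : K) (a : Fin 6 → K) (v : Fin 2 → K) :
    quadMap (c • a) (d • v) = (c * d ^ 2) • quadMap a v := by
  ext i
  fin_cases i <;> simp [quadMap] <;> ring

theorem mk_mem_End2 {a : Fin 6 → K} (ha : a ≠ 0) :
    Projectivization.mk K a ha ∈ End2 K ↔ ∀ x : Fin 2 → K, x ≠ 0 → quadMap a x ≠ 0 := by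
  obtain ⟨c, hc⟩ := Projectivization.exists_smul_eq_mk_rep K a ha
  change (∀ x : Fin 2 → K, x ≠ 0 → quadMap (Projectivization.rep _) x ≠ 0) ↔ _
  refine forall₂_congr fun x _ => ?_
  have := quadMap_smul_smul (c : K) 1 a x
  rw [one_smul] at this
  rw [← hc, Units.smul_def, this]
  simp

theorem End2.app_mk (f : End2 K) {a : Fin 6 → K} (ha : a ≠ 0)
    (hf : f.1 = Projectivization.mk K a ha)
    {v : Fin 2 → K} (hv : v ≠ 0) (h : quadMap a v ≠ 0) :
    End2.app f (Projectivization.mk K v hv) = Projectivization.mk K (quadMap a v) h := by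
  obtain ⟨c, hc⟩ := Projectivization.exists_smul_eq_mk_rep K a ha
  obtain ⟨d, hd⟩ := Projectivization.exists_smul_eq_mk_rep K v hv
  rw [End2.app, Projectivization.mk_eq_mk_iff']
  refine ⟨c * d ^ 2, ?_⟩
  rw [hf, ← hc, ← hd, Units.smul_def, Units.smul_def, quadMap_smul_smul]

theorem mk_mem_MTilde {a : Fin 6 → K} (ha : a ≠ 0) {p : Fin 6 → Fin 2 → K} (hp : ∀ i, p i ≠ 0) :
    ((Projectivization.mk K a ha, fun i => Projectivization.mk K (p i) (hp i)) :
      ℙ K (Fin 6 → K) × (Fin 6 → ℙ K (Fin 2 → K))) ∈ MTilde K ↔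
      (∀ i j, i ≠ j → bracket (p i) (p j) ≠ 0) ∧ (∀ x : Fin 2 → K, x ≠ 0 → quadMap a x ≠ 0) ∧
        ∀ i, bracket (quadMap a (p i)) (p (i + 1)) = 0 := by
  refine and_congr ?_ ⟨?_, ?_⟩
  · refine ⟨fun h i j hij h' => hij (h ((mk_eq_mk_iff_bracket _ _).2 h')), fun h i j hij => ?_⟩
    by_contra hne
    exact h i j hne ((mk_eq_mk_iff_bracket _ _).1 hij)
  · rintro ⟨h, h'⟩
    have hq := (mk_mem_End2 ha).1 h
    refine ⟨hq, fun i => ?_⟩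
    rw [← mk_eq_mk_iff_bracket (hq _ (hp i)) (hp _), ← End2.app_mk ⟨_, h⟩ ha rfl (hp i)]
    exact h' i
  · rintro ⟨h, h'⟩
    refine ⟨(mk_mem_End2 ha).2 h, fun i => ?_⟩
    dsimp only
    rw [End2.app_mk _ ha rfl (hp i) (h _ (hp i)), mk_eq_mk_iff_bracket, h' i]

end HomogeneousCoordinates

section NormalForm

variable {R : Type*} [CommRing R]

/-- Homogeneous coordinates of the points of `normalCycle t`. -/
def normalVec (t : Fin 3 → R) : Fin 6 → Fin 2 → R :=
  ![![0, 1], ![1, 0], ![1, 1], ![t 0, 1], ![t 1, 1], ![t 2, 1]]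

theorem normalVec_ne_zero [Nontrivial R] (t : Fin 3 → R) (i : Fin 6) : normalVec t i ≠ 0 := by
  intro h
  have h0 := congrFun h 0
  have h1 := congrFun h 1
  fin_cases i <;> simp [normalVec] at h0 h1

theorem normalCycle_eq {K : Type*} [Field K] (t : Fin 3 → K) :
    normalCycle t = fun i => Projectivization.mk K (normalVec t i) (normalVec_ne_zero t i) := rfl

/-- The condition that the six points of `normalCycle t` are pairwise distinct. -/
structure DistinctCycle (t : Fin 3 → R) : Prop where
  x_ne_zero : t 0 ≠ 0
  y_ne_zero : t 1 ≠ 0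
  z_ne_zero : t 2 ≠ 0
  x_sub_one : t 0 - 1 ≠ 0
  y_sub_one : t 1 - 1 ≠ 0
  z_sub_one : t 2 - 1 ≠ 0
  x_sub_y : t 0 - t 1 ≠ 0
  x_sub_z : t 0 - t 2 ≠ 0
  y_sub_z : t 1 - t 2 ≠ 0

theorem distinctCycle_iff_bracket_ne_zero [Nontrivial R] {t : Fin 3 → R} :
    DistinctCycle t ↔ ∀ i j, i ≠ j → bracket (normalVec t i) (normalVec t j) ≠ 0 := by
  constructor
  · rintro ⟨hx, hy, hz, hx1, hy1, hz1, hxy, hxz, hyz⟩ i j hij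
    fin_cases i <;> fin_cases j <;> simp [normalVec, bracket] at hij ⊢ <;> grind
  · intro h
    exact
      { x_ne_zero := by simpa [bracket, normalVec] using h 0 3 (by decide)
        y_ne_zero := by simpa [bracket, normalVec] using h 0 4 (by decide)
        z_ne_zero := by simpa [bracket, normalVec] using h 0 5 (by decide)
        x_sub_one := by simpa [bracket, normalVec] using h 3 2 (by decide)
        y_sub_one := by simpa [bracket, normalVec] using h 4 2 (by decide)
        z_sub_one := by simpa [bracket, normalVec] using h 5 2 (by decide)
        x_sub_y := by simpa [bracket, normalVec] using h 3 4 (by decide)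
        x_sub_z := by simpa [bracket, normalVec] using h 3 5 (by decide)
        y_sub_z := by simpa [bracket, normalVec] using h 4 5 (by decide) }

/-- Half the difference `X - Z` of two coordinates of `φ(x, y, z)`. -/
def halfXZ (t : Fin 3 → R) : R := t 0 - t 1 - t 2 + t 1 * t 2

/-- Half the difference `Y - Z` of two coordinates of `φ(x, y, z)`. -/
def halfYZ (t : Fin 3 → R) : R := t 0 * t 1 - t 2

/-- Half the difference `X - Y` of two coordinates of `φ(x, y, z)`. -/
def halfXY (t : Fin 3 → R) : R := t 0 - t 1 + t 1 * t 2 - t 0 * t 1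

/-- The condition on `(x, y, z)` which corresponds to `IsGeneric` under `φ`: the points of the
normal cycle are distinct, and so are the coordinates `X, Y, Z` of `φ(x, y, z)`. -/
structure CycleGeneric (t : Fin 3 → R) : Prop extends DistinctCycle t where
  halfXZ_ne_zero : halfXZ t ≠ 0
  halfYZ_ne_zero : halfYZ t ≠ 0
  halfXY_ne_zero : halfXY t ≠ 0

/-- The polynomial whose vanishing says that `normalCycle t` is the cycle of an endomorphism: up to
sign, the determinant of the three linear equations `CycleEquations` for the coefficients. -/
def cycleRel (t : Fin 3 → R) : R :=
  t 0 ^ 3 * t 1 ^ 2 - t 0 ^ 3 * t 1 * t 2 - t 0 ^ 3 * t 1 + t 0 ^ 3 * t 2 +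
    t 0 ^ 2 * t 1 ^ 2 * t 2 ^ 2 - 2 * t 0 ^ 2 * t 1 ^ 2 * t 2 - t 0 ^ 2 * t 1 * t 2 ^ 2 +
    3 * t 0 ^ 2 * t 1 * t 2 - t 0 ^ 2 * t 2 ^ 2 - t 0 * t 1 ^ 3 * t 2 ^ 2 +
    2 * t 0 * t 1 ^ 3 * t 2 - t 0 * t 1 ^ 3 - t 0 * t 1 ^ 2 * t 2 + t 0 * t 1 ^ 2 +
    t 0 * t 1 * t 2 ^ 3 + t 0 * t 1 * t 2 ^ 2 - 2 * t 0 * t 1 * t 2 - t 1 * t 2 ^ 3 +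
    t 1 * t 2 ^ 2

section Phi

variable {K : Type*} [Field K]

theorem DistinctCycle.mem_affineDomain {t : Fin 3 → K} (h : DistinctCycle t) :
    t ∈ affineDomain K :=
  mul_ne_zero (mul_ne_zero h.y_ne_zero h.y_sub_one) h.x_sub_z

theorem quinticVal_phi (t : Fin 3 → K) :
    quinticVal (phi t) = -2 ^ 5 * (t 1 * (t 1 - 1) * (t 0 - t 2)) * cycleRel t := by
  simp only [quinticVal, phi_apply_zero, phi_apply_one, phi_apply_two, phi_apply_three, cycleRel]
  ring

theorem isGeneric_phi_iff [NeZero (2 : K)] (t : Fin 3 → K) :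
    IsGeneric (phi t) ↔ CycleGeneric t := by
  have h01 : phi t 0 ^ 2 - phi t 1 ^ 2 = 2 ^ 2 * ((t 0 - t 2) * (t 1 - 1) * (t 0 - t 1)) := by
    simp only [phi_apply_zero, phi_apply_one]; ring
  have h02 : phi t 0 ^ 2 - phi t 2 ^ 2 = -2 ^ 2 * ((t 1 - t 2) * t 1 * (t 0 - t 2)) := by
    simp only [phi_apply_zero, phi_apply_two]; ring
  have h03 : phi t 0 ^ 2 - phi t 3 ^ 2 = -2 ^ 2 * (t 1 * (t 0 - 1) * t 2 * (t 1 - 1)) := by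
    simp only [phi_apply_zero, phi_apply_three]; ring
  have h12 : phi t 1 ^ 2 - phi t 2 ^ 2 = 2 ^ 2 * ((t 0 - t 2) * halfXY t) := by
    simp only [phi_apply_one, phi_apply_two, halfXY]; ring
  have h23 : phi t 2 ^ 2 - phi t 3 ^ 2 = -2 ^ 2 * (t 1 * (t 2 - 1) * halfYZ t) := by
    simp only [phi_apply_two, phi_apply_three, halfYZ]; ring
  have h13 : phi t 1 ^ 2 - phi t 3 ^ 2 = -2 ^ 2 * (t 0 * (t 1 - 1) * halfXZ t) := by
    simp only [phi_apply_one, phi_apply_three, halfXZ]; ring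
  have h4 : (2 : K) ^ 2 ≠ 0 := pow_ne_zero _ two_ne_zero
  rw [← not_iff_not, ← eval_boundaryPoly_eq_zero_iff, eval_boundaryPoly, quadForm_phi,
    h01, h02, h03, h12, h23, h13, ← not_iff_not]
  simp only [mul_eq_zero, neg_eq_zero, h4, false_or, not_or, not_not]
  constructor
  · rintro ⟨⟨⟨⟨⟨⟨⟨⟨hy, -⟩, hxz⟩, ⟨-, hy1⟩, hxy⟩, ⟨hyz, -⟩, -⟩, ⟨⟨-, hx1⟩, hz⟩, -⟩, -, hXY⟩,
      ⟨-, hz1⟩, hYZ⟩, ⟨hx, -⟩, hXZ⟩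
    exact ⟨⟨hx, hy, hz, hx1, hy1, hz1, hxy, hxz, hyz⟩, hXZ, hYZ, hXY⟩
  · rintro ⟨⟨hx, hy, hz, hx1, hy1, hz1, hxy, hxz, hyz⟩, hXZ, hYZ, hXY⟩
    have hy1' : 1 - t 1 ≠ 0 := sub_ne_zero.2 (sub_ne_zero.1 hy1).symm
    tauto

end Phi

/-- The coefficients of `[u:v] ↦ [(u - zv)(su + cv) : u(su + dv)]`, the shape of a quadratic map
sending `[z:1]`, `[0:1]`, `[1:0]` to `[0:1]`, `[1:0]`, `[1:1]`. -/
def cycleForm (z s c d : R) : Fin 6 → R := ![s, c - s * z, -(z * c), s, d, 0]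

/-- The conditions for the map with coefficients `cycleForm (t 2) s c d` to send `[1:1]` to
`[x:1]`, `[x:1]` to `[y:1]` and `[y:1]` to `[z:1]`, where `t = (x, y, z)`. -/
structure CycleEquations (t : Fin 3 → R) (s c d : R) : Prop where
  one : (1 - t 2) * (s + c) - t 0 * (s + d) = 0
  two : (t 0 - t 2) * (s * t 0 + c) - t 0 * t 1 * (s * t 0 + d) = 0
  three : (t 1 - t 2) * (s * t 1 + c) - t 1 * t 2 * (s * t 1 + d) = 0

theorem CycleEquations.mul_cycleRel {t : Fin 3 → R} {s c d : R} (h : CycleEquations t s c d) :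
    s * cycleRel t = 0 := by
  unfold cycleRel
  linear_combination -((t 0 - t 2) * (t 1 * t 2) - (t 1 - t 2) * (t 0 * t 1)) * h.one +
    ((1 - t 2) * (t 1 * t 2) - (t 1 - t 2) * t 0) * h.two -
    ((1 - t 2) * (t 0 * t 1) - (t 0 - t 2) * t 0) * h.three

/-- Up to the factor `x`, the second coordinate of the solution of `CycleEquations`. -/
def numC (t : Fin 3 → R) : R := t 0 * (t 0 * t 1 - t 0 + t 2) - t 1 * (t 0 - 1 + t 2)

/-- The third coordinate of the solution of `CycleEquations`. -/
def numD (t : Fin 3 → R) : R :=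
  (1 - t 2) * (t 0 ^ 2 * t 1 - t 0 ^ 2 + t 0 * t 2) - (t 0 - t 2) * (t 0 - 1 + t 2)

/-- The coefficients of the endomorphism whose cycle is `normalCycle t`. The last three arguments
of `cycleForm` are the cross product of the first two rows of the system `CycleEquations`. -/
def endoCoef (t : Fin 3 → R) : Fin 6 → R :=
  cycleForm (t 2) (t 0 * halfXZ t) (t 0 * numC t) (numD t)

theorem cycleEquations_of_cycleRel {t : Fin 3 → R} (h : cycleRel t = 0) :
    CycleEquations t (t 0 * halfXZ t) (t 0 * numC t) (numD t) := by
  unfold cycleRel at h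
  refine ⟨?_, ?_, ?_⟩ <;> simp only [halfXZ, numC, numD]
  · ring
  · ring
  · linear_combination h

theorem CycleEquations.smul_cycleForm {t : Fin 3 → R} {s c d : R} (h : CycleEquations t s c d) :
    (t 0 * halfXZ t) • cycleForm (t 2) s c d = s • endoCoef t := by
  have hc : t 0 * halfXZ t * c = s * (t 0 * numC t) := by
    unfold halfXZ numC
    linear_combination -(t 0 * t 1) * h.one + t 0 * h.two
  have hd : t 0 * halfXZ t * d = s * numD t := by
    unfold halfXZ numD
    linear_combination -(t 0 - t 2) * h.one + (1 - t 2) * h.two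
  ext i
  fin_cases i <;> simp only [cycleForm, endoCoef, Pi.smul_apply, smul_eq_mul, Fin.zero_eta,
    Fin.mk_one, Fin.reduceFinMk, Matrix.cons_val]
  · ring
  · linear_combination hc
  · linear_combination -t 2 * hc
  · ring
  · exact hd
  · simp

theorem CycleEquations.halfXZ_ne_zero [IsDomain R] {t : Fin 3 → R} {s c d : R}
    (ht : DistinctCycle t) (h : CycleEquations t s c d) (hs : s ≠ 0) (hcd : c - d ≠ 0) :
    halfXZ t ≠ 0 := by
  intro h0
  unfold halfXZ at h0
  have h1 : t 1 * ((1 - t 2) * (s * t 0 + c) - t 0 * (s * t 0 + d)) = 0 := by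
    linear_combination h.two - (s * t 0 + c) * h0
  have h2 : s * (t 0 - 1) * (1 - t 2 - t 0) = 0 := by
    linear_combination (mul_eq_zero.1 h1).resolve_left ht.y_ne_zero - h.one
  have h3 := (mul_eq_zero.1 h2).resolve_left (mul_ne_zero hs ht.x_sub_one)
  refine mul_ne_zero ht.x_ne_zero hcd ?_
  linear_combination h.one - (s + c) * h3

theorem mul_numC_sub_numD (t : Fin 3 → R) :
    t 0 * numC t - numD t = (t 0 - 1) * (t 0 - 1 + t 2) * (t 0 * t 1 - t 0 + t 2) := by
  unfold numC numD
  ring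

theorem numD_add (t : Fin 3 → R) :
    numD t + t 0 * halfXZ t * t 2 = (t 2 - 1) * (t 0 - t 2) * (2 * t 0 - t 0 * t 1 - 1) := by
  unfold halfXZ numD
  ring

section Nondegenerate

variable [IsDomain R] {t : Fin 3 → R}

theorem CycleGeneric.numC_ne_zero (ht : CycleGeneric t) (h : cycleRel t = 0) : numC t ≠ 0 := by
  intro h'
  refine mul_ne_zero (mul_ne_zero (mul_ne_zero (mul_ne_zero (mul_ne_zero ht.x_ne_zero
    ht.y_ne_zero) ht.x_sub_one) ht.y_sub_one) ht.halfXZ_ne_zero) ht.halfYZ_ne_zero ?_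
  unfold halfXZ halfYZ
  unfold cycleRel at h
  unfold numC at h'
  linear_combination (t 0 - t 1) * h + (t 0 ^ 2 * t 1 ^ 2 - t 0 ^ 2 * t 1 + t 0 ^ 2 * t 2 +
    t 0 * t 1 ^ 3 * t 2 - t 0 * t 1 ^ 3 - t 0 * t 1 ^ 2 * t 2 + t 0 * t 1 ^ 2 -
    t 0 * t 1 * t 2 ^ 2 - t 0 * t 1 * t 2 + t 1 * t 2 ^ 2) * h'

theorem CycleGeneric.mul_numC_sub_numD_ne_zero (ht : CycleGeneric t) (h : cycleRel t = 0) :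
    t 0 * numC t - numD t ≠ 0 := by
  unfold cycleRel at h
  rw [mul_numC_sub_numD]
  refine mul_ne_zero (mul_ne_zero ht.x_sub_one fun h' => ?_) fun h' => ?_
  · refine mul_ne_zero (mul_ne_zero (mul_ne_zero ht.x_ne_zero ht.x_sub_y) ht.halfXZ_ne_zero)
      ht.halfYZ_ne_zero ?_
    unfold halfXZ halfYZ
    linear_combination -h + (t 0 ^ 3 * t 1 + t 0 ^ 2 * t 1 ^ 2 * t 2 - t 0 ^ 2 * t 1 ^ 2 -
      3 * t 0 ^ 2 * t 1 * t 2 - t 0 * t 1 ^ 3 * t 2 + t 0 * t 1 ^ 3 + t 0 * t 1 ^ 2 * t 2 -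
      t 0 * t 1 ^ 2 + t 0 * t 1 * t 2 ^ 2 + 2 * t 0 * t 1 * t 2 - t 1 * t 2 ^ 2) * h'
  · refine mul_ne_zero (mul_ne_zero (mul_ne_zero ht.x_ne_zero ht.y_sub_one) ht.halfXZ_ne_zero)
      ht.halfXY_ne_zero ?_
    unfold halfXZ halfXY
    linear_combination -h + (-t 0 ^ 2 * t 2 + t 0 ^ 2 - t 0 * t 1 ^ 2 * t 2 + t 0 * t 1 ^ 2 +
      t 0 * t 1 * t 2 ^ 2 + t 0 * t 1 * t 2 - 2 * t 0 * t 1 - t 1 * t 2 ^ 2 + t 1 * t 2) * h'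

theorem CycleGeneric.numD_add_ne_zero (ht : CycleGeneric t) (h : cycleRel t = 0) :
    numD t + t 0 * halfXZ t * t 2 ≠ 0 := by
  rw [numD_add]
  refine mul_ne_zero (mul_ne_zero ht.z_sub_one ht.x_sub_z) fun h' => ?_
  refine mul_ne_zero (mul_ne_zero (mul_ne_zero ht.x_ne_zero ht.halfXZ_ne_zero) ht.y_sub_z)
    ht.halfXY_ne_zero ?_
  unfold halfXZ halfXY
  unfold cycleRel at h
  linear_combination -h + (t 0 * t 1 ^ 2 * t 2 - t 0 * t 1 ^ 2 - 2 * t 0 * t 1 * t 2 ^ 2 +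
    2 * t 0 * t 1 * t 2 + t 1 * t 2 ^ 3 - t 1 * t 2 ^ 2) * h'

theorem DistinctCycle.halfYZ_ne_zero (ht : DistinctCycle t) (h : cycleRel t = 0)
    (hC : numC t ≠ 0) (hCD : t 0 * numC t - numD t ≠ 0) : halfYZ t ≠ 0 := by
  rw [mul_numC_sub_numD] at hCD
  intro h'
  refine mul_ne_zero (mul_ne_zero (mul_ne_zero (mul_ne_zero ht.x_ne_zero ht.y_ne_zero)
    ht.y_sub_one) (right_ne_zero_of_mul (left_ne_zero_of_mul hCD))) hC ?_
  unfold halfYZ at h'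
  unfold cycleRel at h
  unfold numC
  linear_combination h + (t 0 ^ 3 * t 1 ^ 2 - 2 * t 0 ^ 3 * t 1 + t 0 ^ 3 +
    t 0 ^ 2 * t 1 ^ 2 * t 2 - 2 * t 0 ^ 2 * t 1 ^ 2 + 2 * t 0 ^ 2 * t 1 - t 0 ^ 2 * t 2 -
    2 * t 0 * t 1 ^ 2 * t 2 + 2 * t 0 * t 1 ^ 2 + t 0 * t 1 * t 2 ^ 2 + t 0 * t 1 * t 2 -
    2 * t 0 * t 1 - t 1 * t 2 ^ 2 + t 1 * t 2) * h'

theorem DistinctCycle.halfXY_ne_zero (ht : DistinctCycle t) (h : cycleRel t = 0)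
    (hCD : t 0 * numC t - numD t ≠ 0) (hD : numD t + t 0 * halfXZ t * t 2 ≠ 0) :
    halfXY t ≠ 0 := by
  rw [mul_numC_sub_numD] at hCD
  rw [numD_add] at hD
  intro h'
  refine mul_ne_zero ht.y_ne_zero (mul_ne_zero hD (right_ne_zero_of_mul hCD)) ?_
  unfold halfXY at h'
  unfold cycleRel at h
  linear_combination -h + (t 0 ^ 2 * t 1 ^ 2 * t 2 - t 0 ^ 2 * t 1 ^ 2 -
    2 * t 0 ^ 2 * t 1 * t 2 + t 0 ^ 2 * t 1 + t 0 ^ 2 * t 2 - t 0 * t 1 ^ 2 * t 2 +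
    t 0 * t 1 ^ 2 + t 0 * t 1 * t 2 ^ 2 + t 0 * t 1 * t 2 - t 0 * t 1 - t 0 * t 2 ^ 2) * h'

end Nondegenerate

section EndomorphismOfCycle

variable {K : Type*} [Field K] {t : Fin 3 → K}

theorem quadMap_cycleForm (z s c d : K) (v : Fin 2 → K) :
    quadMap (cycleForm z s c d) v =
      ![(v 0 - z * v 1) * (s * v 0 + c * v 1), v 0 * (s * v 0 + d * v 1)] := by
  ext i
  fin_cases i <;> simp [quadMap, cycleForm] <;> ring

theorem quadMap_cycleForm_ne_zero_iff {z s c d : K} :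
    (∀ v : Fin 2 → K, v ≠ 0 → quadMap (cycleForm z s c d) v ≠ 0) ↔
      s ≠ 0 ∧ z * c ≠ 0 ∧ c - d ≠ 0 ∧ d + s * z ≠ 0 := by
  simp only [quadMap_cycleForm]
  constructor
  · intro h
    have hs : s ≠ 0 := fun h0 => h ![1, 0] (by simp) (by simp [h0])
    refine ⟨hs, fun h0 => h ![0, 1] (by simp) (by simp [h0]), fun h0 => ?_, fun h0 => ?_⟩
    · refine h ![-c, s] (by simp [hs]) ?_
      rw [← sub_eq_zero.1 h0]
      simp [mul_comm]
    · refine h ![z, 1] (by simp) ?_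
      simp [add_comm (s * z), h0]
  · rintro ⟨hs, hzc, hcd, hd⟩ v hv hq
    have e0 : (v 0 - z * v 1) * (s * v 0 + c * v 1) = 0 := congrFun hq 0
    have e1 : v 0 * (s * v 0 + d * v 1) = 0 := congrFun hq 1
    have hv1 : v 1 = 0 := by
      rcases mul_eq_zero.1 e1 with h1 | h1
      · rw [h1] at e0
        refine pow_eq_zero_iff two_ne_zero |>.1 ((mul_eq_zero.1 ?_).resolve_left hzc)
        linear_combination -e0
      · rcases mul_eq_zero.1 e0 with h0 | h0
        · exact (mul_eq_zero.1 (by linear_combination h1 - s * h0)).resolve_left hd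
        · exact (mul_eq_zero.1 (by linear_combination h0 - h1)).resolve_left hcd
    have hv0 : v 0 = 0 := by simpa [hv1, hs] using e1
    refine hv (funext fun i => ?_)
    fin_cases i
    exacts [hv0, hv1]

theorem cycleEquations_iff_bracket_eq_zero {s c d : K} :
    CycleEquations t s c d ↔ ∀ i, bracket (quadMap (cycleForm (t 2) s c d) (normalVec t i))
      (normalVec t (i + 1)) = 0 := by
  simp only [quadMap_cycleForm, bracket]
  constructor
  · rintro ⟨h1, h2, h3⟩ i
    fin_cases i <;> simp [normalVec]
    · linear_combination h1
    · linear_combination h2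
    · linear_combination h3
  · intro h
    exact
      { one := by simpa [normalVec, mul_comm (s + d)] using h 2
        two := by simpa [normalVec, mul_comm, mul_left_comm, mul_assoc] using h 3
        three := by simpa [normalVec, mul_comm, mul_left_comm, mul_assoc] using h 4 }

theorem eq_cycleForm_of_bracket_eq_zero {a : Fin 6 → K}
    (h : ∀ i, bracket (quadMap a (normalVec t i)) (normalVec t (i + 1)) = 0) :
    a = cycleForm (t 2) (a 0) (a 1 + a 0 * t 2) (a 4) := by
  have h0 : a 5 = 0 := by simpa [bracket, normalVec, quadMap] using h 0
  have h1 : a 0 - a 3 = 0 := by simpa [bracket, normalVec, quadMap] using h 1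
  have h5 : a 0 * t 2 ^ 2 + a 1 * t 2 + a 2 = 0 := by
    simpa [bracket, normalVec, quadMap] using h 5
  ext i
  fin_cases i
  · rfl
  · exact (add_sub_cancel_right _ _).symm
  · change a 2 = -(t 2 * (a 1 + a 0 * t 2))
    linear_combination h5
  · exact (sub_eq_zero.1 h1).symm
  · rfl
  · exact h0

theorem CycleGeneric.quadMap_endoCoef_ne_zero (ht : CycleGeneric t) (h : cycleRel t = 0) :
    ∀ v : Fin 2 → K, v ≠ 0 → quadMap (endoCoef t) v ≠ 0 :=
  quadMap_cycleForm_ne_zero_iff.2 ⟨mul_ne_zero ht.x_ne_zero ht.halfXZ_ne_zero,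
    mul_ne_zero ht.z_ne_zero (mul_ne_zero ht.x_ne_zero (ht.numC_ne_zero h)),
    ht.mul_numC_sub_numD_ne_zero h, ht.numD_add_ne_zero h⟩

theorem cycleGeneric_of_cycle {a : Fin 6 → K}
    (hp : ∀ i j, i ≠ j → bracket (normalVec t i) (normalVec t j) ≠ 0)
    (hq : ∀ x : Fin 2 → K, x ≠ 0 → quadMap a x ≠ 0)
    (hc : ∀ i, bracket (quadMap a (normalVec t i)) (normalVec t (i + 1)) = 0) :
    CycleGeneric t ∧ cycleRel t = 0 ∧ ∃ l : K, endoCoef t = l • a := by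
  have ht := distinctCycle_iff_bracket_ne_zero.2 hp
  have ha := eq_cycleForm_of_bracket_eq_zero hc
  generalize a 0 = s, a 1 + a 0 * t 2 = c, a 4 = d at ha
  subst ha
  have he := cycleEquations_iff_bracket_eq_zero.2 hc
  obtain ⟨hs, -, hcd, -⟩ := quadMap_cycleForm_ne_zero_iff.1 hq
  have hXZ := he.halfXZ_ne_zero ht hs hcd
  have hrel : cycleRel t = 0 := (mul_eq_zero.1 he.mul_cycleRel).resolve_left hs
  have hl : endoCoef t = (s⁻¹ * (t 0 * halfXZ t)) • cycleForm (t 2) s c d := by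
    rw [mul_smul, he.smul_cycleForm, inv_smul_smul₀ hs]
  have hq' : ∀ x : Fin 2 → K, x ≠ 0 → quadMap (endoCoef t) x ≠ 0 := by
    intro x hx
    have := quadMap_smul_smul (s⁻¹ * (t 0 * halfXZ t)) 1 (cycleForm (t 2) s c d) x
    rw [one_smul, ← hl] at this
    rw [this]
    exact smul_ne_zero (by simp [hs, hXZ, ht.x_ne_zero]) (hq x hx)
  obtain ⟨-, hzC, hCD, hD⟩ := quadMap_cycleForm_ne_zero_iff.1 hq'
  have hC := right_ne_zero_of_mul (right_ne_zero_of_mul hzC)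
  exact ⟨⟨ht, hXZ, ht.halfYZ_ne_zero hrel hC hCD, ht.halfXY_ne_zero hrel hCD hD⟩, hrel, _, hl⟩

/-- The point of `MTilde K` whose cycle is `normalCycle t`. -/
def normalPoint (ht : CycleGeneric t) (h : cycleRel t = 0) : MTilde K :=
  ⟨(Projectivization.mk K (endoCoef t)
      fun h0 => mul_ne_zero ht.x_ne_zero ht.halfXZ_ne_zero (congrFun h0 0), normalCycle t),
    (mk_mem_MTilde _ (normalVec_ne_zero t)).2
      ⟨distinctCycle_iff_bracket_ne_zero.1 ht.toDistinctCycle, ht.quadMap_endoCoef_ne_zero h,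
        cycleEquations_iff_bracket_eq_zero.1 (cycleEquations_of_cycleRel h)⟩⟩

theorem eq_normalPoint (m : MTilde K) (hm : m.1.2 = normalCycle t) :
    ∃ (ht : CycleGeneric t) (h : cycleRel t = 0), m = normalPoint ht h := by
  obtain ⟨⟨f, p⟩, hmem⟩ := m
  dsimp only at hm
  subst hm
  induction f with
  | h a ha =>
    obtain ⟨hp, hq, hc⟩ := (mk_mem_MTilde ha (normalVec_ne_zero t)).1 hmem
    obtain ⟨ht, h, l, hl⟩ := cycleGeneric_of_cycle hp hq hc
    exact ⟨ht, h, Subtype.ext (Prod.ext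
      (.symm ((Projectivization.mk_eq_mk_iff' K _ _ _ _).2 ⟨l, hl.symm⟩)) rfl)⟩

end EndomorphismOfCycle

end NormalForm

section CrossRatio

variable {K : Type*} [Field K]

/-- The cross-ratio, as the coordinate of `s` for which `p, q, r` are `0, ∞, 1`. -/
def crossRatio (p q r s : Fin 2 → K) : K :=
  bracket p s * bracket q r / (bracket q s * bracket p r)

theorem crossRatio_smul {a b c d : K} (ha : a ≠ 0) (hb : b ≠ 0) (hc : c ≠ 0) (hd : d ≠ 0)
    (p q r s : Fin 2 → K) :
    crossRatio (a • p) (b • q) (c • r) (d • s) = crossRatio p q r s := by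
  simp only [crossRatio, bracket_smul_smul]
  rw [← mul_div_mul_left (bracket p s * bracket q r) _
    (mul_ne_zero (mul_ne_zero ha hb) (mul_ne_zero hc hd))]
  ring

theorem crossRatio_mulVec {M : Matrix (Fin 2) (Fin 2) K} (hM : M.det ≠ 0) (p q r s : Fin 2 → K) :
    crossRatio (M.mulVec p) (M.mulVec q) (M.mulVec r) (M.mulVec s) = crossRatio p q r s := by
  simp only [crossRatio, bracket_mulVec]
  rw [← mul_div_mul_left (bracket p s * bracket q r) _ (mul_ne_zero hM hM)]
  ring

/-- The coordinates `x, y, z` of the normal form of a cycle: the cross-ratios of its first three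
points with each of the other three. -/
def cycleCoord (p : Fin 6 → ℙ K (Fin 2 → K)) : Fin 3 → K :=
  fun j => crossRatio (p 0).rep (p 1).rep (p 2).rep (p (Fin.natAdd 3 j)).rep

theorem cycleCoord_mk {p : Fin 6 → Fin 2 → K} (hp : ∀ i, p i ≠ 0) (j : Fin 3) :
    cycleCoord (fun i => Projectivization.mk K (p i) (hp i)) j =
      crossRatio (p 0) (p 1) (p 2) (p (Fin.natAdd 3 j)) := by
  choose c hc using fun i => Projectivization.exists_smul_eq_mk_rep K (p i) (hp i)
  simp only [cycleCoord, ← hc, Units.smul_def]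
  exact crossRatio_smul (c 0).ne_zero (c 1).ne_zero (c 2).ne_zero (c _).ne_zero _ _ _ _

theorem exists_eq_mk {ι V : Type*} [AddCommGroup V] [Module K V] (p : ι → ℙ K V) :
    ∃ (v : ι → V) (hv : ∀ i, v i ≠ 0), p = fun i => Projectivization.mk K (v i) (hv i) :=
  ⟨fun i => (p i).rep, fun i => (p i).rep_nonzero, funext fun i => (p i).mk_rep.symm⟩

theorem cycleCoord_smul (ν : PGL(Fin 2, K)) (p : Fin 6 → ℙ K (Fin 2 → K)) :
    cycleCoord (fun i => ν • p i) = cycleCoord p := by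
  obtain ⟨g, rfl⟩ := Matrix.ProjGenLinGroup.mk_surjective ν
  obtain ⟨v, hv, rfl⟩ := exists_eq_mk p
  ext j
  simp only [Projectivization.PGL.mk_smul_mk]
  rw [cycleCoord_mk, cycleCoord_mk]
  exact crossRatio_mulVec (Matrix.GeneralLinearGroup.det_ne_zero g) _ _ _ _

theorem cycleCoord_normalCycle (t : Fin 3 → K) : cycleCoord (normalCycle t) = t := by
  ext j
  rw [normalCycle_eq, cycleCoord_mk]
  fin_cases j <;> simp [crossRatio, bracket, normalVec, Fin.natAdd]

/-- The matrix sending the points `p, q, r` of `ℙ¹` to `0, ∞, 1`. -/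
def normalizer (p q r : Fin 2 → K) : Matrix (Fin 2) (Fin 2) K :=
  !![-(p 1 * bracket q r), p 0 * bracket q r; -(q 1 * bracket p r), q 0 * bracket p r]

theorem normalizer_mulVec (p q r v : Fin 2 → K) :
    (normalizer p q r).mulVec v = ![bracket q r * bracket p v, bracket p r * bracket q v] := by
  ext i
  fin_cases i <;> simp [normalizer, bracket, Matrix.mulVec, dotProduct, Fin.sum_univ_two] <;> ring

theorem det_normalizer (p q r : Fin 2 → K) :
    (normalizer p q r).det = bracket q r * bracket p r * bracket p q := by
  simp only [normalizer, bracket, Matrix.det_fin_two_of]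
  ring

theorem bracket_normalizer_mulVec {p q r s : Fin 2 → K} (hpr : bracket p r ≠ 0)
    (hqs : bracket q s ≠ 0) :
    bracket ((normalizer p q r).mulVec s) ![crossRatio p q r s, 1] = 0 := by
  rw [normalizer_mulVec, crossRatio, bracket]
  simp only [Matrix.cons_val]
  field_simp
  ring

theorem exists_smul_eq_normalCycle {p : Fin 6 → ℙ K (Fin 2 → K)} (hp : Function.Injective p) :
    ∃ ν : PGL(Fin 2, K), (fun i => ν • p i) = normalCycle (cycleCoord p) := by
  obtain ⟨v, hv, rfl⟩ := exists_eq_mk p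
  have hb (i j : Fin 6) (hij : i ≠ j) : bracket (v i) (v j) ≠ 0 :=
    fun h => hij (hp ((mk_eq_mk_iff_bracket _ _).2 h))
  have hdet : (normalizer (v 0) (v 1) (v 2)).det ≠ 0 := by
    rw [det_normalizer]
    exact mul_ne_zero (mul_ne_zero (hb 1 2 (by decide)) (hb 0 2 (by decide))) (hb 0 1 (by decide))
  have hcoord (j : Fin 3) := bracket_normalizer_mulVec (hb 0 2 (by decide))
    (hb 1 (Fin.natAdd 3 j) (by revert j; decide))
  simp only [← cycleCoord_mk hv] at hcoord
  refine ⟨.mk (Matrix.GeneralLinearGroup.mkOfDetNeZero _ hdet), funext fun i => ?_⟩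
  rw [Projectivization.PGL.mk_smul_mk, normalCycle_eq, mk_eq_mk_iff_bracket]
  change bracket ((normalizer (v 0) (v 1) (v 2)).mulVec (v i)) _ = 0
  fin_cases i
  · change bracket ((normalizer _ _ _).mulVec (v 0)) ![0, 1] = 0
    rw [normalizer_mulVec, bracket_self]
    simp [bracket]
  · change bracket ((normalizer _ _ _).mulVec (v 1)) ![1, 0] = 0
    rw [normalizer_mulVec, bracket_self]
    simp [bracket]
  · change bracket ((normalizer _ _ _).mulVec (v 2)) ![1, 1] = 0
    rw [normalizer_mulVec]
    simp [bracket, mul_comm]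
  · exact hcoord 0
  · exact hcoord 1
  · exact hcoord 2

end CrossRatio

section Conjugation

variable {K : Type*} [Field K]

/-- The coefficients of the conjugate of a quadratic map by a matrix, up to the square of the
determinant: the two forms are composed with the adjugate of `M`, and the resulting pair is
multiplied by `M`. -/
def conjCoef (M : Matrix (Fin 2) (Fin 2) K) (a : Fin 6 → K) : Fin 6 → K :=
  let b (c : Fin 3 → K) : Fin 3 → K :=
    ![c 0 * M 1 1 ^ 2 - c 1 * M 1 1 * M 1 0 + c 2 * M 1 0 ^ 2,
      -2 * c 0 * M 1 1 * M 0 1 + c 1 * (M 1 1 * M 0 0 + M 0 1 * M 1 0) - 2 * c 2 * M 1 0 * M 0 0,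
      c 0 * M 0 1 ^ 2 - c 1 * M 0 1 * M 0 0 + c 2 * M 0 0 ^ 2]
  let p := b ![a 0, a 1, a 2]
  let q := b ![a 3, a 4, a 5]
  ![M 0 0 * p 0 + M 0 1 * q 0, M 0 0 * p 1 + M 0 1 * q 1, M 0 0 * p 2 + M 0 1 * q 2,
    M 1 0 * p 0 + M 1 1 * q 0, M 1 0 * p 1 + M 1 1 * q 1, M 1 0 * p 2 + M 1 1 * q 2]

theorem quadMap_conjCoef (M : Matrix (Fin 2) (Fin 2) K) (a : Fin 6 → K) (v : Fin 2 → K) :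
    quadMap (conjCoef M a) (M.mulVec v) = M.det ^ 2 • M.mulVec (quadMap a v) := by
  ext i
  fin_cases i <;> simp [quadMap, conjCoef, Matrix.mulVec, dotProduct, Fin.sum_univ_two,
    Matrix.det_fin_two] <;> ring

theorem End2.exists_conj (ν : PGL(Fin 2, K)) (f : End2 K) :
    ∃ f' : End2 K, ∀ x, End2.app f' (ν • x) = ν • End2.app f x := by
  obtain ⟨g, rfl⟩ := Matrix.ProjGenLinGroup.mk_surjective ν
  have hconj (v : Fin 2 → K) :
      quadMap (conjCoef g f.1.rep) (g • v) = g.1.det ^ 2 • g • quadMap f.1.rep v :=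
    quadMap_conjCoef g.1 _ v
  have hdet := Matrix.GeneralLinearGroup.det_ne_zero g
  have hne (x : Fin 2 → K) (hx : x ≠ 0) : quadMap (conjCoef g f.1.rep) x ≠ 0 := by
    rw [← smul_inv_smul g x, hconj]
    exact smul_ne_zero (pow_ne_zero 2 hdet)
      ((smul_ne_zero_iff_ne g).2 (f.2 _ ((smul_ne_zero_iff_ne g⁻¹).2 hx)))
  have h0 : conjCoef g f.1.rep ≠ 0 := by
    intro h
    refine hne 1 one_ne_zero ?_
    rw [h]
    ext i
    fin_cases i <;> simp [quadMap]
  refine ⟨⟨_, (mk_mem_End2 h0).2 hne⟩, fun x => ?_⟩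
  induction x with
  | h v hv =>
    rw [End2.app_mk f f.1.rep_nonzero f.1.mk_rep.symm hv (f.2 v hv),
      Projectivization.PGL.mk_smul_mk, Projectivization.PGL.mk_smul_mk,
      End2.app_mk _ h0 rfl _ (hne _ ((smul_ne_zero_iff_ne g).2 hv)),
      Projectivization.mk_eq_mk_iff']
    exact ⟨_, (hconj v).symm⟩

theorem Moduli.exists_mk_eq_smul (ν : PGL(Fin 2, K)) (m : MTilde K) :
    ∃ m' : MTilde K, (m'.1.2 = fun i => ν • m.1.2 i) ∧ Moduli.mk m' = Moduli.mk m := by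
  obtain ⟨f, hf⟩ := End2.exists_conj ν (endo m)
  refine ⟨⟨(f.1, fun i => ν • m.1.2 i), (MulAction.injective ν).comp m.2.1, f.2, fun i =>
    (hf _).trans (congrArg (ν • ·) (m.2.2.2 i))⟩, rfl, ?_⟩
  exact Quotient.sound ((orbitSetoid K).symm ⟨ν, hf, fun _ => rfl⟩)

end Conjugation

section NormalFormOfClass

variable {K : Type*} [Field K]

theorem Moduli.exists_normal (m : MTilde K) :
    ∃ m' : MTilde K, m'.1.2 = normalCycle (cycleCoord m.1.2) ∧ Moduli.mk m' = Moduli.mk m := by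
  obtain ⟨ν, hν⟩ := exists_smul_eq_normalCycle m.2.1
  obtain ⟨m', hm', e⟩ := Moduli.exists_mk_eq_smul ν m
  exact ⟨m', hm'.trans hν, e⟩

/-- The coordinates of the normal form of a class. -/
def Moduli.coord : Moduli K → Fin 3 → K :=
  Quotient.lift (fun m : MTilde K => cycleCoord m.1.2) (by
    rintro m n ⟨ν, -, h⟩
    rw [show n.1.2 = fun i => ν • m.1.2 i from funext h, cycleCoord_smul])

theorem Moduli.coord_mk (m : MTilde K) : (Moduli.mk m).coord = cycleCoord m.1.2 := rfl

theorem Moduli.exists_mk_normalPoint_eq (c : Moduli K) :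
    ∃ (ht : CycleGeneric c.coord) (h : cycleRel c.coord = 0), Moduli.mk (normalPoint ht h) = c := by
  induction c using Quotient.ind with | _ m =>
  obtain ⟨m', hm', e⟩ := Moduli.exists_normal m
  obtain ⟨ht, h, rfl⟩ := eq_normalPoint m' hm'
  exact ⟨ht, h, e⟩

theorem Moduli.cycleGeneric_coord (c : Moduli K) : CycleGeneric c.coord :=
  c.exists_mk_normalPoint_eq.1

theorem Moduli.cycleRel_coord (c : Moduli K) : cycleRel c.coord = 0 :=
  c.exists_mk_normalPoint_eq.2.1

theorem Moduli.mk_normalPoint_coord (c : Moduli K) :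
    Moduli.mk (normalPoint c.cycleGeneric_coord c.cycleRel_coord) = c :=
  c.exists_mk_normalPoint_eq.2.2

theorem Moduli.coord_mk_of_eq_normalCycle {m : MTilde K} {t : Fin 3 → K}
    (hm : m.1.2 = normalCycle t) : (Moduli.mk m).coord = t := by
  rw [Moduli.coord_mk, hm, cycleCoord_normalCycle]

theorem Moduli.coord_injective : Function.Injective (Moduli.coord (K := K)) := by
  intro c d h
  rw [← c.mk_normalPoint_coord, ← d.mk_normalPoint_coord]
  congr

theorem Moduli.existsUnique_normal (c : Moduli K) :
    ∃! t : Fin 3 → K, ∃ m : MTilde K, m.1.2 = normalCycle t ∧ Moduli.mk m = c := by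
  refine ⟨c.coord, ⟨_, rfl, c.mk_normalPoint_coord⟩, ?_⟩
  rintro t ⟨m, hm, rfl⟩
  exact (Moduli.coord_mk_of_eq_normalCycle hm).symm

end NormalFormOfClass

section OpenPart

variable {K : Type*} [Field K]

/-- The open subset of the quintic which is isomorphic to the moduli space. -/
def openPart (K : Type*) [Field K] : Set (ℙ K (Fin 4 → K)) := S6 K \ projZeros (boundaryPoly K)

theorem openPart_eq_setOf : openPart K =
    {p ∈ S6 K | quadForm p.rep ≠ 0 ∧ Function.Injective fun i => p.rep i ^ 2} :=
  Set.ext fun _ => and_congr_right fun _ => not_iff_comm.1 eval_boundaryPoly_eq_zero_iff.symm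

theorem mk_mem_openPart {v : Fin 4 → K} (hv : v ≠ 0) :
    Projectivization.mk K v hv ∈ openPart K ↔ quinticVal v = 0 ∧ IsGeneric v := by
  rw [openPart, Set.mem_sdiff, mk_mem_S6, mk_mem_projZeros (boundaryPoly_isHomogeneous K),
    eval_boundaryPoly_eq_zero_iff, not_not]

theorem IsGeneric.mem_coneDomain {v : Fin 4 → K} (hv : IsGeneric v) : v ∈ coneDomain K := by
  have h (i j : Fin 4) (hij : i ≠ j) : (v i - v j) * (v i + v j) ≠ 0 := by
    intro h
    exact hij (hv.2 (by linear_combination h))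
  exact mul_ne_zero (mul_ne_zero (mul_ne_zero hv.1 (right_ne_zero_of_mul (h 1 2 (by decide))))
    (right_ne_zero_of_mul (h 0 2 (by decide)))) (left_ne_zero_of_mul (h 0 1 (by decide)))

theorem openPart_subset_projDomain : openPart K ⊆ projDomain K := by
  rw [openPart_eq_setOf]
  exact fun _ hp => IsGeneric.mem_coneDomain hp.2

/-- The effect of the rotation of a cycle on its coordinates. -/
def rotateCoord (t : Fin 3 → K) : Fin 3 → K :=
  ![(t 0 - 1) / (t 1 - 1), (t 0 - 1) / (t 2 - 1), 1 - t 0]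

theorem cycleCoord_rotate (t : Fin 3 → K) :
    cycleCoord (fun i => normalCycle t (i + 1)) = rotateCoord t := by
  have hdiv (a b : K) : (1 - a) / (1 - b) = (a - 1) / (b - 1) := by
    rw [← neg_sub a, ← neg_sub b, neg_div_neg_eq]
  ext j
  rw [normalCycle_eq, cycleCoord_mk (fun i => normalVec_ne_zero t (i + 1))]
  fin_cases j <;> simp [crossRatio, bracket, normalVec, Fin.natAdd, rotateCoord, hdiv]

theorem Moduli.coord_sigma6 (c : Moduli K) : (sigma6 c).coord = rotateCoord c.coord := by
  conv_lhs => rw [← c.mk_normalPoint_coord]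
  exact cycleCoord_rotate c.coord

theorem phi_rotateCoord {t : Fin 3 → K} (hy : t 1 - 1 ≠ 0) (hz : t 2 - 1 ≠ 0) :
    phi (rotateCoord t) = (-(t 0 - 1) / ((t 1 - 1) * (t 2 - 1))) • tauLin (phi t) := by
  ext i
  fin_cases i <;> simp [phi, rotateCoord, tauLin] <;> field_simp <;> ring

variable [NeZero (2 : K)]

theorem mk_phi_mem_openPart {t : Fin 3 → K} (ht : CycleGeneric t) (h : cycleRel t = 0) :
    Projectivization.mk K (phi t) (phi_ne_zero ht.mem_affineDomain) ∈ openPart K := by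
  rw [mk_mem_openPart, quinticVal_phi, h, mul_zero, isGeneric_phi_iff]
  exact ⟨rfl, ht⟩

theorem mk_phi_psi_rep {p : ℙ K (Fin 4 → K)} (hp : p ∈ projDomain K) :
    Projectivization.mk K (phi (psi p.rep)) (phi_ne_zero (psi_mem_affineDomain hp)) = p :=
  (mk_phi_psi hp).trans p.mk_rep

theorem cycleGeneric_psi_rep {p : ℙ K (Fin 4 → K)} (hp : p ∈ openPart K) :
    CycleGeneric (psi p.rep) := by
  rw [← mk_phi_psi_rep (openPart_subset_projDomain hp), mk_mem_openPart, isGeneric_phi_iff] at hp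
  exact hp.2

theorem cycleRel_psi_rep {p : ℙ K (Fin 4 → K)} (hp : p ∈ openPart K) :
    cycleRel (psi p.rep) = 0 := by
  have hd := openPart_subset_projDomain hp
  rw [← mk_phi_psi_rep hd, mk_mem_openPart, quinticVal_phi] at hp
  exact (mul_eq_zero.1 hp.1).resolve_left
    (mul_ne_zero (neg_ne_zero.2 (pow_ne_zero 5 two_ne_zero)) (psi_mem_affineDomain hd))

/-- The bijection between the moduli space and an open subset of the quintic. -/
def moduliEquiv (K : Type*) [Field K] [NeZero (2 : K)] : Moduli K ≃ openPart K where
  toFun c := ⟨Projectivization.mk K (phi c.coord)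
      (phi_ne_zero c.cycleGeneric_coord.mem_affineDomain),
    mk_phi_mem_openPart c.cycleGeneric_coord c.cycleRel_coord⟩
  invFun p := Moduli.mk (normalPoint (cycleGeneric_psi_rep p.2) (cycleRel_psi_rep p.2))
  left_inv c := Moduli.coord_injective <| (Moduli.coord_mk_of_eq_normalCycle rfl).trans <|
    (psi_rep_mk _).trans (psi_phi c.cycleGeneric_coord.mem_affineDomain)
  right_inv p := by
    refine Subtype.ext (Eq.trans ?_ (mk_phi_psi_rep (openPart_subset_projDomain p.2)))
    dsimp only
    congr 1
    exact congrArg phi (Moduli.coord_mk_of_eq_normalCycle rfl)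

theorem moduliEquiv_mk (m : MTilde K) (t : Fin 3 → K) (hm : m.1.2 = normalCycle t) :
    ∃ h : phi t ≠ 0, (moduliEquiv K (Moduli.mk m)).1 = Projectivization.mk K (phi t) h := by
  obtain rfl := Moduli.coord_mk_of_eq_normalCycle hm
  exact ⟨_, rfl⟩

theorem moduliEquiv_sigma6 (c : Moduli K) :
    (moduliEquiv K (sigma6 c)).1 = tau (moduliEquiv K c).1 := by
  have ht := c.cycleGeneric_coord
  change Projectivization.mk K _ _ = Projectivization.map _ _ (Projectivization.mk K _ _)
  rw [Projectivization.map_mk, Projectivization.mk_eq_mk_iff', c.coord_sigma6,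
    phi_rotateCoord ht.y_sub_one ht.z_sub_one]
  exact ⟨_, rfl⟩

end OpenPart

section ModuliIso

open FunSpace MvPolynomial

variable (k : Type*) (K : Type*) [Field k] [Field K] [Algebra k K]

/-- The points of the product of the cones over the factors of `ℙ⁵ × (ℙ¹)⁶`. -/
abbrev AmbientCone := {a : Fin 6 → K // a ≠ 0} × (Fin 6 → {v : Fin 2 → K // v ≠ 0})

variable {K} in
/-- The coordinates embedding the product of the cones over the factors of `ℙ⁵ × (ℙ¹)⁶` into an
affine space. -/
def ambientConeCoord (c : AmbientCone K) : Fin 6 ⊕ (Fin 6 × Fin 2) → K :=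
  Sum.elim c.1.1 fun ij => (c.2 ij.1).1 ij.2

variable {K} in
/-- The projection of the product of the cones to `ℙ⁵ × (ℙ¹)⁶`. -/
def ambientProj (c : AmbientCone K) : ℙ K (Fin 6 → K) × (Fin 6 → ℙ K (Fin 2 → K)) :=
  (Projectivization.mk' K c.1, fun i => Projectivization.mk' K (c.2 i))

/-- The product of the cones over the factors of `ℙ⁵ × (ℙ¹)⁶`, as a subspace of an affine space. -/
def ambientConeSpace : FunSpace K (AmbientCone K) :=
  (affineSpace k K (Fin 6 ⊕ (Fin 6 × Fin 2))).induced ambientConeCoord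

theorem ambientSpace_eq_quotient :
    ambientSpace k K = (ambientConeSpace k K).quotient ambientProj := rfl

theorem isLocallyRinged_ambientConeSpace : IsLocallyRinged k (ambientConeSpace k K) :=
  (isLocallyRinged_affineSpace k K _).induced _

theorem isLocallyRinged_MTilde :
    IsLocallyRinged k ((ambientSpace k K).induced (Subtype.val : MTilde K → _)) :=
  ((isLocallyRinged_ambientConeSpace k K).quotient ambientProj).induced _

theorem isLocallyRinged_moduliSpace : IsLocallyRinged k (moduliSpace k K) :=
  (isLocallyRinged_MTilde k K).quotient _

theorem regular_bracket (i j : Fin 6) :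
    (ambientConeSpace k K).regular Set.univ fun c => bracket (c.2 i).1 (c.2 j).1 :=
  (isLocallyRinged_ambientConeSpace k K).regular_of_eq_aeval
    (hom_induced (affineSpace k K _) ambientConeCoord).regular_coord
    (bracket (fun a => X (.inr (i, a))) fun a => X (.inr (j, a)))
    fun c => by simp [bracket, ambientConeCoord]

/-- The open subset of `ℙ⁵ × (ℙ¹)⁶` where the denominators of the cross-ratios do not vanish. -/
def crossRatioDomain : Set (ℙ K (Fin 6 → K) × (Fin 6 → ℙ K (Fin 2 → K))) :=
  {q | q.2 1 ≠ q.2 3 ∧ q.2 1 ≠ q.2 4 ∧ q.2 1 ≠ q.2 5 ∧ q.2 0 ≠ q.2 2}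

variable {K} in
theorem ambientProj_mem_crossRatioDomain {c : AmbientCone K} :
    ambientProj c ∈ crossRatioDomain K ↔
      (∀ j : Fin 3, bracket (c.2 1).1 (c.2 (Fin.natAdd 3 j)).1 ≠ 0) ∧
        bracket (c.2 0).1 (c.2 2).1 ≠ 0 := by
  have h (i j : Fin 6) : (ambientProj c).2 i ≠ (ambientProj c).2 j ↔
      bracket (c.2 i).1 (c.2 j).1 ≠ 0 := not_congr (mk_eq_mk_iff_bracket (c.2 i).2 (c.2 j).2)
  simp [crossRatioDomain, h, Fin.forall_fin_succ, Fin.natAdd, and_assoc]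

theorem isOpen_preimage_crossRatioDomain :
    IsOpen[(ambientConeSpace k K).top] (ambientProj ⁻¹' crossRatioDomain K) := by
  have hA := isLocallyRinged_ambientConeSpace k K
  have hb := regular_bracket k K
  convert hA.isOpen_ne (isOpen_univ _)
    (hA.mul (hA.mul (hA.mul (hb 1 3) (hb 1 4)) (hb 1 5)) (hb 0 2)) using 1
  ext c
  rw [Set.mem_preimage, ambientProj_mem_crossRatioDomain]
  simp [Fin.forall_fin_succ, Fin.natAdd, and_assoc]

theorem hom_cycleCoord_crossRatioDomain :
    Hom ((ambientSpace k K).induced (Subtype.val : crossRatioDomain K → _))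
      (affineSpace k K (Fin 3)) fun q => cycleCoord q.1.2 := by
  have hA := isLocallyRinged_ambientConeSpace k K
  have hB := hA.induced (Subtype.val : ambientProj ⁻¹' crossRatioDomain K → AmbientCone K)
  have hb (i j : Fin 6) := (hom_induced (ambientConeSpace k K)
    (Subtype.val : ambientProj ⁻¹' crossRatioDomain K → _)).regular (regular_bracket k K i j)
  rw [ambientSpace_eq_quotient]
  refine .of_comp_quotient_restrict hA (isOpen_preimage_crossRatioDomain k K)
    (.into_affineSpace hB fun j => ?_)
  refine hB.congr (fun c _ => (cycleCoord_mk (fun i => (c.1.2 i).2) j).symm) ?_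
  refine hB.div (hB.mul (hb _ _) (hb _ _)) (hB.mul (hb _ _) (hb _ _)) fun c _ => ?_
  obtain ⟨h, h02⟩ := ambientProj_mem_crossRatioDomain.1 c.2
  exact mul_ne_zero (h j) h02

theorem hom_cycleCoord :
    Hom ((ambientSpace k K).induced (Subtype.val : MTilde K → _))
      (affineSpace k K (Fin 3)) fun m => cycleCoord m.1.2 := by
  have h : Hom ((ambientSpace k K).induced (Subtype.val : MTilde K → _))
      ((ambientSpace k K).induced (Subtype.val : crossRatioDomain K → _))
      fun m => ⟨m.1, m.2.1.ne (by decide), m.2.1.ne (by decide), m.2.1.ne (by decide),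
        m.2.1.ne (by decide)⟩ :=
    .into_induced (isLocallyRinged_MTilde k K) (hom_induced _ _)
  exact (hom_cycleCoord_crossRatioDomain k K).comp h

theorem hom_moduliEquiv [NeZero (2 : K)] :
    Hom (moduliSpace k K) ((projSpace k K 4).induced Subtype.val) (moduliEquiv K) :=
  .into_induced (isLocallyRinged_moduliSpace k K) <| .of_comp_quotient <|
    .into_projSpace (isLocallyRinged_MTilde k K)
      (fun m => phi_ne_zero (Moduli.mk m).cycleGeneric_coord.mem_affineDomain)
      (regular_phi (isLocallyRinged_MTilde k K) (hom_cycleCoord k K).regular_coord)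

variable {k K}

section Sections

variable {T : Type*} {A : FunSpace K T} {t : T → Fin 3 → K}

theorem regular_endoCoef (hA : IsLocallyRinged k A) (ht : ∀ i, A.regular Set.univ fun x => t x i)
    (i : Fin 6) : A.regular Set.univ fun x => endoCoef (t x) i :=
  hA.regular_of_eq_aeval ht (endoCoef X i) fun x => by
    fin_cases i <;> simp [endoCoef, cycleForm, halfXZ, numC, numD]

theorem regular_normalVec (hA : IsLocallyRinged k A) (ht : ∀ i, A.regular Set.univ fun x => t x i)
    (i : Fin 6) (j : Fin 2) : A.regular Set.univ fun x => normalVec (t x) i j :=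
  hA.regular_of_eq_aeval ht (normalVec X i j) fun x => by
    fin_cases i <;> fin_cases j <;> simp [normalVec]

end Sections

variable (k K)

theorem hom_psi_openPart : Hom ((projSpace k K 4).induced (Subtype.val : openPart K → _))
    (affineSpace k K (Fin 3)) fun p => psi p.1.rep := by
  have hA := (isLocallyRinged_projSpace k K 4).induced (Subtype.val : openPart K → _)
  have h : Hom ((projSpace k K 4).induced (Subtype.val : openPart K → _))
      ((projSpace k K 4).induced (Subtype.val : projDomain K → _))
      (Set.inclusion openPart_subset_projDomain) := .into_induced hA (hom_induced _ _)
  exact (hom_psi k K).comp h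

theorem isOpen_openPart :
    IsOpen[((projSpace k K 4).induced (Subtype.val : S6 K → _)).top]
      (Subtype.val ⁻¹' openPart K) := by
  refine ⟨(projZeros (boundaryPoly K))ᶜ, ⟨_, isOpen_aeval_ne_zero (boundaryPoly k), ?_⟩, ?_⟩
  · ext v
    have h : aeval v.1 (boundaryPoly k) = eval v.1 (boundaryPoly K) := by simp [boundaryPoly]
    simp only [Set.mem_preimage, Set.mem_ofPred_eq, Set.mem_compl_iff, h, ne_eq]
    exact not_congr (mk_mem_projZeros (boundaryPoly_isHomogeneous K) v.2).symm
  · ext p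
    exact (and_iff_right p.2).symm

variable [NeZero (2 : K)]

theorem hom_moduliEquiv_symm :
    Hom ((projSpace k K 4).induced Subtype.val) (moduliSpace k K) (moduliEquiv K).symm := by
  have hA := (isLocallyRinged_projSpace k K 4).induced (Subtype.val : openPart K → _)
  have hpsi := (hom_psi_openPart k K).regular_coord
  let lift (p : openPart K) : AmbientCone K :=
    have ht := cycleGeneric_psi_rep p.2
    (⟨endoCoef (psi p.1.rep), fun h0 => mul_ne_zero ht.x_ne_zero ht.halfXZ_ne_zero
      (congrFun h0 0)⟩, fun i => ⟨normalVec (psi p.1.rep) i, normalVec_ne_zero _ i⟩)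
  have hom_lift : Hom ((projSpace k K 4).induced Subtype.val) (ambientConeSpace k K) lift := by
    refine .into_induced hA (.into_affineSpace hA ?_)
    rintro (i | ⟨i, j⟩)
    · exact regular_endoCoef hA hpsi i
    · exact regular_normalVec hA hpsi i j
  have hom_normalPoint : Hom ((projSpace k K 4).induced Subtype.val)
      ((ambientSpace k K).induced (Subtype.val : MTilde K → _))
      fun p : openPart K => normalPoint (cycleGeneric_psi_rep p.2) (cycleRel_psi_rep p.2) :=
    .into_induced hA ((hom_quotient (ambientConeSpace k K) ambientProj).comp hom_lift)
  exact (hom_quotient _ Moduli.mk).comp hom_normalPoint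

theorem moduliEquiv_isIso :
    IsIso (moduliSpace k K) ((projSpace k K 4).induced Subtype.val) (moduliEquiv K) :=
  isIso_of_hom (hom_moduliEquiv k K) (hom_moduliEquiv_symm k K)

end ModuliIso

end M26

end

theorem proposition2_general (k : Type*) (K : Type*) [Field k] [CharZero k]
    [Field K] [Algebra k K] :
    ((quintic K).IsHomogeneous 5 ∧ Irreducible (quintic K)) ∧
    (∃ e : affineDomain K ≃ projDomain K,
      FunSpace.IsIso ((affineSpace k K (Fin 3)).induced Subtype.val)
        ((projSpace k K 4).induced Subtype.val) e ∧
      (∀ t : affineDomain K, ∃ h : phi t.1 ≠ 0, (e t).1 = Projectivization.mk K (phi t.1) h) ∧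
      ∀ p : projDomain K, (e.symm p).1 = psi p.1.rep) ∧
    (∀ c : Moduli K, ∃! t : Fin 3 → K, ∃ m : MTilde K, m.1.2 = normalCycle t ∧ Moduli.mk m = c) ∧
    ∃ (U : Set (ℙ K (Fin 4 → K))) (Φ : Moduli K ≃ U),
      U ⊆ S6 K ∧
      IsOpen[((projSpace k K 4).induced (Subtype.val : S6 K → _)).top] (Subtype.val ⁻¹' U) ∧
      FunSpace.IsIso (moduliSpace k K) ((projSpace k K 4).induced Subtype.val) Φ ∧
      (∀ (m : MTilde K) (t : Fin 3 → K), m.1.2 = normalCycle t →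
        ∃ h : phi t ≠ 0, (Φ (Moduli.mk m)).1 = Projectivization.mk K (phi t) h) ∧
      (∀ c : Moduli K, (Φ (sigma6 c)).1 = tau (Φ c).1) ∧
      S6 K \ U = (⋃ i, lineCurve K i) ∪ ⋃ i, conicCurve K i ∧
      (∀ i, IsLine (lineCurve K i)) ∧
      (∀ i, IsConic (conicCurve K i)) ∧
      Function.Injective (Sum.elim (lineCurve K) (conicCurve K)) ∧
      ((boundaryPoly K).IsHomogeneous 14 ∧ boundaryPoly K ≠ 0 ∧
        S6 K \ U = S6 K ∩ projZeros (boundaryPoly K)) ∧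
      U = {p ∈ S6 K | quadForm p.rep ≠ 0 ∧ Function.Injective fun i => p.rep i ^ 2} := by
  have : CharZero K := charZero_of_injective_algebraMap (algebraMap k K).injective
  have hcompl : S6 K \ openPart K = S6 K ∩ projZeros (boundaryPoly K) :=
    Set.sdiff_sdiff_right_self _ _
  exact ⟨⟨quintic_isHomogeneous K, quintic_irreducible K⟩,
    ⟨phiEquiv K, phiEquiv_isIso k K, fun t => ⟨phi_ne_zero t.2, rfl⟩, fun _ => rfl⟩,
    Moduli.existsUnique_normal,
    openPart K, moduliEquiv K, fun _ hp => hp.1, isOpen_openPart k K, moduliEquiv_isIso k K,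
    moduliEquiv_mk, moduliEquiv_sigma6,
    hcompl.trans (S6_inter_boundaryPoly.trans iUnion_curve),
    isLine_lineCurve, isConic_conicCurve, curve_injective,
    ⟨boundaryPoly_isHomogeneous K, boundaryPoly_ne_zero K, hcompl⟩, openPart_eq_setOf⟩

theorem proposition2 (k : Type*) (K : Type*) [Field k] [CharZero k]
    [Field K] [IsAlgClosed K] [Algebra k K] :
    -- the surface is an irreducible quintic
    ((quintic K).IsHomogeneous 5 ∧ Irreducible (quintic K)) ∧
    -- the rational map `φ` is birational with inverse `ψ`
    (∃ e : affineDomain K ≃ projDomain K,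
      FunSpace.IsIso ((affineSpace k K (Fin 3)).induced Subtype.val)
        ((projSpace k K 4).induced Subtype.val) e ∧
      (∀ t : affineDomain K, ∃ h : phi t.1 ≠ 0, (e t).1 = Projectivization.mk K (phi t.1) h) ∧
      ∀ p : projDomain K, (e.symm p).1 = psi p.1.rep) ∧
    -- every class has a unique normal form, which embeds the moduli space into affine 3-space
    (∀ c : Moduli K, ∃! t : Fin 3 → K, ∃ m : MTilde K, m.1.2 = normalCycle t ∧ Moduli.mk m = c) ∧
    ∃ (U : Set (ℙ K (Fin 4 → K))) (Φ : Moduli K ≃ U),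
      -- `Φ` is an isomorphism to an open subset of the quintic, given by `φ` on normal forms
      U ⊆ S6 K ∧
      IsOpen[((projSpace k K 4).induced (Subtype.val : S6 K → _)).top] (Subtype.val ⁻¹' U) ∧
      FunSpace.IsIso (moduliSpace k K) ((projSpace k K 4).induced Subtype.val) Φ ∧
      (∀ (m : MTilde K) (t : Fin 3 → K), m.1.2 = normalCycle t →
        ∃ h : phi t ≠ 0, (Φ (Moduli.mk m)).1 = Projectivization.mk K (phi t) h) ∧
      -- the action of the rotation of the cycle
      (∀ c : Moduli K, (Φ (sigma6 c)).1 = tau (Φ c).1) ∧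
      -- the complement is the union of nine lines and fourteen conics
      S6 K \ U = (⋃ i, lineCurve K i) ∪ ⋃ i, conicCurve K i ∧
      (∀ i, IsLine (lineCurve K i)) ∧
      (∀ i, IsConic (conicCurve K i)) ∧
      Function.Injective (Sum.elim (lineCurve K) (conicCurve K)) ∧
      -- it is cut out by a hypersurface of positive degree
      ((boundaryPoly K).IsHomogeneous 14 ∧ boundaryPoly K ≠ 0 ∧
        S6 K \ U = S6 K ∩ projZeros (boundaryPoly K)) ∧
      -- the open subset in coordinates
      U = {p ∈ S6 K | quadForm p.rep ≠ 0 ∧ Function.Injective fun i => p.rep i ^ 2} := by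
  exact proposition2_general k K
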